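/- Let $\Gamma$ be a non-trivial group. An ordering on a group is a total order relation $\preceq$ that is invariant under left multiplication ($a\preceq b$ implies $ca\preceq cb$). Let $\mathcal{LO}(\Gamma)$ be the set of all orderings on $\Gamma$, with the topology having as a subbasis the sets $U_f=\{\preceq\;:\;f\succ 1\}$, $f\in\Gamma\setminus\{1\}$. An ordering is Conradian if for all $f\succ 1$ and $g\succ 1$ there exists $n\in\mathbb{N}$ such that $fg^n\succ g$. A subset $S\subseteq\Gamma$ is $\preceq$-convex if for all $f_1,f_2\in S$ every $f\in\Gamma$ with $f_1\prec f\prec f_2$ belongs to $S$. The Conradian soul $C_{\preceq}(\Gamma)$ is the unique maximal subgroup among the subgroups of $\Gamma$ that are $\preceq$-convex and to which $\preceq$ restricts as a Conradian ordering. If $\preceq$ is an isolated point of $\mathcal{LO}(\Gamma)$, that is, if $\{\preceq\}$ is open in $\mathcal{LO}(\Gamma)$, then the Conradian soul $C_{\preceq}(\Gamma)$ is non-trivial, and $\mathcal{LO}(C_{\preceq}(\Gamma))$ is finite. -/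

import Mathlib

/-- An ordering on a group: a total order relation that is invariant under left
multiplication. -/
@[ext]
structure LeftOrdering (Γ : Type*) [Group Γ] where
  /-- The (non-strict) order relation. -/
  le : Γ → Γ → Prop
  le_refl : ∀ a, le a a
  le_trans : ∀ a b c, le a b → le b c → le a c
  le_antisymm : ∀ a b, le a b → le b a → a = b
  le_total : ∀ a b, le a b ∨ le b a
  mul_le_mul_left : ∀ a b c, le a b → le (c * a) (c * b)

namespace LeftOrdering

variable {Γ : Type*} [Group Γ]

/-- The strict order relation. -/
def lt (o : LeftOrdering Γ) (a b : Γ) : Prop := o.le a b ∧ a ≠ b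

/-- The topology on the space of orderings: it has as a subbasis the sets
`{o | 1 < f for o}`, where `f ≠ 1`. -/
instance instTopologicalSpace : TopologicalSpace (LeftOrdering Γ) :=
  TopologicalSpace.generateFrom {U | ∃ f : Γ, f ≠ 1 ∧ U = {o : LeftOrdering Γ | o.lt 1 f}}

/-- The restriction of an ordering to a subgroup. -/
def restrict (o : LeftOrdering Γ) (H : Subgroup Γ) : LeftOrdering H where
  le a b := o.le a b
  le_refl a := o.le_refl a
  le_trans a b c := o.le_trans a b c
  le_antisymm a b hab hba := Subtype.ext (o.le_antisymm a b hab hba)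
  le_total a b := o.le_total a b
  mul_le_mul_left a b c := o.mul_le_mul_left a b c

/-- An ordering is Conradian if for all positive `f`, `g` there is a natural number `n` with
`f * g ^ n > g`. (Allowing `n = 0` makes no difference: if `f > g` with `g` positive, then also
`f * g > f > g`.) -/
def IsConradian (o : LeftOrdering Γ) : Prop :=
  ∀ f g : Γ, o.lt 1 f → o.lt 1 g → ∃ n : ℕ, o.lt g (f * g ^ n)

/-- Convexity of a subset of an ordered group. -/
def IsConvex (o : LeftOrdering Γ) (S : Set Γ) : Prop :=
  ∀ f₁ ∈ S, ∀ f₂ ∈ S, ∀ f : Γ, o.lt f₁ f → o.lt f f₂ → f ∈ S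

/-- The subgroups that are convex and on which the restricted ordering is Conradian. -/
def IsConvexConradian (o : LeftOrdering Γ) (C : Subgroup Γ) : Prop :=
  o.IsConvex (C : Set Γ) ∧ (o.restrict C).IsConradian

/-- The Conradian soul: the largest convex Conradian subgroup. It is written here as the join
of all convex Conradian subgroups; `isGreatest_conradianSoul` and
`maximal_isConvexConradian_iff` show that this join is itself convex and Conradian, and that it
is the unique maximal subgroup with these two properties. -/
def conradianSoul (o : LeftOrdering Γ) : Subgroup Γ :=
  sSup {C : Subgroup Γ | o.IsConvexConradian C}

theorem lt_trichotomy (o : LeftOrdering Γ) (a b : Γ) : o.lt a b ∨ a = b ∨ o.lt b a := by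
  by_cases h : a = b
  · exact Or.inr (Or.inl h)
  · rcases o.le_total a b with h' | h'
    · exact Or.inl ⟨h', h⟩
    · exact Or.inr (Or.inr ⟨h', Ne.symm h⟩)

theorem mul_lt_mul_left (o : LeftOrdering Γ) {a b : Γ} (c : Γ) (h : o.lt a b) :
    o.lt (c * a) (c * b) :=
  ⟨o.mul_le_mul_left a b c h.1, fun e => h.2 (mul_left_cancel e)⟩

/-- A subgroup that is not contained in another has a positive element outside of it. -/
theorem exists_pos_of_not_le (o : LeftOrdering Γ) {C D : Subgroup Γ} (h : ¬ C ≤ D) :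
    ∃ x ∈ C, x ∉ D ∧ o.lt 1 x := by
  obtain ⟨x, hxC, hxD⟩ := SetLike.not_le_iff_exists.1 h
  rcases o.lt_trichotomy 1 x with h1 | h1 | h1
  · exact ⟨x, hxC, hxD, h1⟩
  · exact absurd (h1 ▸ D.one_mem) hxD
  · refine ⟨x⁻¹, C.inv_mem hxC, fun h2 => hxD (by simpa using D.inv_mem h2), ?_⟩
    simpa using o.mul_lt_mul_left x⁻¹ h1

/-- Convex subgroups are linearly ordered by inclusion. -/
theorem IsConvex.le_total {o : LeftOrdering Γ} {C D : Subgroup Γ}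
    (hC : o.IsConvex (C : Set Γ)) (hD : o.IsConvex (D : Set Γ)) : C ≤ D ∨ D ≤ C := by
  by_contra! h
  obtain ⟨x, hxC, hxD, hx⟩ := o.exists_pos_of_not_le h.1
  obtain ⟨y, hyD, hyC, hy⟩ := o.exists_pos_of_not_le h.2
  rcases o.lt_trichotomy x y with h1 | h1 | h1
  · exact hxD (hD 1 D.one_mem y hyD x hx h1)
  · exact hxD (h1 ▸ hyD)
  · exact hyC (hC 1 C.one_mem x hxC y hy h1)

theorem isConvexConradian_bot (o : LeftOrdering Γ) : o.IsConvexConradian ⊥ := by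
  refine ⟨?_, fun f g hf _ => absurd (Subsingleton.elim _ _) hf.2⟩
  intro f₁ h₁ f₂ h₂ f hf hf'
  have e₁ : f₁ = 1 := by simpa using h₁
  have e₂ : f₂ = 1 := by simpa using h₂
  subst e₁ e₂
  exact absurd (o.le_antisymm _ _ hf.1 hf'.1) hf.2

theorem directedOn_isConvexConradian (o : LeftOrdering Γ) :
    DirectedOn (· ≤ ·) {C : Subgroup Γ | o.IsConvexConradian C} := by
  intro C hC D hD
  rcases hC.1.le_total hD.1 with h | h
  · exact ⟨D, hD, h, le_rfl⟩
  · exact ⟨C, hC, le_rfl, h⟩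

theorem mem_conradianSoul (o : LeftOrdering Γ) {x : Γ} :
    x ∈ o.conradianSoul ↔ ∃ C : Subgroup Γ, o.IsConvexConradian C ∧ x ∈ C := by
  unfold conradianSoul
  rw [Subgroup.mem_sSup_of_directedOn ⟨⊥, o.isConvexConradian_bot⟩
    o.directedOn_isConvexConradian]
  rfl

/-- The Conradian soul is convex and Conradian, and contains every such subgroup. -/
theorem isGreatest_conradianSoul (o : LeftOrdering Γ) :
    IsGreatest {C : Subgroup Γ | o.IsConvexConradian C} o.conradianSoul := by
  have key : ∀ x ∈ o.conradianSoul, ∀ y ∈ o.conradianSoul,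
      ∃ C : Subgroup Γ, o.IsConvexConradian C ∧ x ∈ C ∧ y ∈ C := by
    intro x hx y hy
    obtain ⟨C, hC, hxC⟩ := o.mem_conradianSoul.1 hx
    obtain ⟨D, hD, hyD⟩ := o.mem_conradianSoul.1 hy
    rcases hC.1.le_total hD.1 with h | h
    · exact ⟨D, hD, h hxC, hyD⟩
    · exact ⟨C, hC, hxC, h hyD⟩
  refine ⟨⟨?_, ?_⟩, fun C hC => le_sSup hC⟩
  · intro f₁ h₁ f₂ h₂ f hf hf'
    obtain ⟨C, hC, h₁C, h₂C⟩ := key f₁ h₁ f₂ h₂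
    exact o.mem_conradianSoul.2 ⟨C, hC, hC.1 f₁ h₁C f₂ h₂C f hf hf'⟩
  · intro f g hf hg
    obtain ⟨C, hC, hfC, hgC⟩ := key f f.2 g g.2
    obtain ⟨n, hn⟩ := hC.2 ⟨f, hfC⟩ ⟨g, hgC⟩
      ⟨hf.1, fun e => hf.2 (Subtype.ext (show (1 : Γ) = f from congrArg Subtype.val e))⟩
      ⟨hg.1, fun e => hg.2 (Subtype.ext (show (1 : Γ) = g from congrArg Subtype.val e))⟩
    exact ⟨n, hn.1, fun e => hn.2 (Subtype.ext
      (show (g : Γ) = f * (g : Γ) ^ n from congrArg Subtype.val e))⟩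

/-- The Conradian soul is the unique maximal convex Conradian subgroup. -/
theorem maximal_isConvexConradian_iff (o : LeftOrdering Γ) (C : Subgroup Γ) :
    Maximal o.IsConvexConradian C ↔ C = o.conradianSoul := by
  have h := o.isGreatest_conradianSoul
  constructor
  · intro hC
    exact _root_.le_antisymm (h.2 hC.1) (hC.2 h.1 (h.2 hC.1))
  · rintro rfl
    exact ⟨h.1, fun D hD _ => h.2 hD⟩

end LeftOrdering

/-! An isolated ordering is pinned down by a finite set `F` of positive elements (`IsolatedBy`): any
other ordering that keeps `F` positive must coincide with it. Most steps deform the ordering while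
keeping `F` positive and read off what the coincidence means.

Non-triviality (`IsolatedBy.exists_convex_invariant`): conjugating the ordering by an element
between `1` and `min F` keeps `F` positive, so conjugation by such elements preserves the positive
cone. The same holds for the convex subgroup generated by `min F`, on which the ordering is
therefore Conradian.

Finiteness: the restriction to the soul is again isolated, and it is Conradian;
`IsolatedBy.finite_of_isConradian` then argues by induction on the size of `F`. There are finitely
many convex subgroups; let `N` be the largest proper one. By Conrad's argument `N` is normal with
archimedean quotient. The quotient ordering is isolated, hence bi-invariant by the first part, hence
commutative by Hölder, and of rank one because two independent elements would allow a perturbation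
inside the reals (`IsolatedBy.rankOneMod`).

By induction `N` has finitely many orderings, all with the same convex subgroups, so its largest
proper convex subgroup `N'` is characteristic. Some element reverses the signs on `N / N'`
(`IsolatedBy.exists_isReversedBy`): otherwise the ordering on `G / N'` is bi-invariant, and it can
be deformed, by a real homomorphism if the group is commutative, and by comparing `g * x * g⁻¹` with
`x` if not. The reversal forces `N` to be convex for every ordering (`IsReversedBy.isConvex`); if
`N` is trivial this is automatic. An ordering is then determined by its restriction to `N` and one
sign. -/

namespace LeftOrdering

variable {G : Type*} [Group G]

/-! ### Positive cones and convex subgroups -/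

/-- An element is positive if it is greater than `1`. -/
def Pos (o : LeftOrdering G) (g : G) : Prop := o.lt 1 g

theorem lt_iff_pos (o : LeftOrdering G) {a b : G} : o.lt a b ↔ o.Pos (a⁻¹ * b) := by
  constructor
  · intro h
    simpa [Pos] using o.mul_lt_mul_left a⁻¹ h
  · intro h
    simpa [Pos] using o.mul_lt_mul_left a h

theorem not_pos_one (o : LeftOrdering G) : ¬ o.Pos 1 := fun h => h.2 rfl

theorem Pos.ne_one {o : LeftOrdering G} {g : G} (h : o.Pos g) : g ≠ 1 := fun e => h.2 e.symm

theorem lt_trans (o : LeftOrdering G) {a b c : G} (h : o.lt a b) (h' : o.lt b c) : o.lt a c :=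
  ⟨o.le_trans _ _ _ h.1 h'.1, fun e => h.2 (o.le_antisymm _ _ h.1 (e ▸ h'.1))⟩

theorem Pos.mul {o : LeftOrdering G} {g h : G} (hg : o.Pos g) (hh : o.Pos h) : o.Pos (g * h) :=
  o.lt_trans hg (by simpa using o.mul_lt_mul_left g hh)

theorem Pos.not_inv {o : LeftOrdering G} {g : G} (hg : o.Pos g) : ¬ o.Pos g⁻¹ := fun h =>
  o.not_pos_one (by simpa using hg.mul h)

theorem pos_or (o : LeftOrdering G) {g : G} (hg : g ≠ 1) : o.Pos g ∨ o.Pos g⁻¹ := by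
  rcases o.lt_trichotomy 1 g with h | h | h
  · exact Or.inl h
  · exact absurd h.symm hg
  · exact Or.inr (by simpa [Pos] using o.mul_lt_mul_left g⁻¹ h)

theorem pos_inv_of_not (o : LeftOrdering G) {g : G} (hg : g ≠ 1) (h : ¬ o.Pos g) : o.Pos g⁻¹ :=
  (o.pos_or hg).resolve_left h

theorem Pos.pow {o : LeftOrdering G} {g : G} (hg : o.Pos g) {n : ℕ} (hn : 0 < n) :
    o.Pos (g ^ n) := by
  induction n, hn using Nat.le_induction with
  | base => simpa using hg
  | succ n _ ih => rw [pow_succ]; exact ih.mul hg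

theorem pos_of_pow (o : LeftOrdering G) {g : G} {n : ℕ} (h : o.Pos (g ^ n)) : o.Pos g := by
  have hn : 0 < n := Nat.pos_of_ne_zero fun e => by simp [e, o.not_pos_one] at h
  by_contra hg
  rcases eq_or_ne g 1 with rfl | h1
  · simp [o.not_pos_one] at h
  · have := (o.pos_inv_of_not h1 hg).pow hn
    rw [inv_pow] at this
    exact h.not_inv this

theorem eq_of_pos_imp {o o' : LeftOrdering G} (h : ∀ g, o.Pos g → o'.Pos g) : o' = o := by
  have key : ∀ g, o'.Pos g ↔ o.Pos g := by
    refine fun g => ⟨fun hg => ?_, h g⟩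
    by_contra hn
    exact hg.not_inv (h _ (o.pos_inv_of_not hg.ne_one hn))
  have le_iff : ∀ (o : LeftOrdering G) a b, o.le a b ↔ a = b ∨ o.Pos (a⁻¹ * b) := by
    intro o a b
    rw [← o.lt_iff_pos]
    constructor
    · intro h
      by_cases e : a = b
      · exact Or.inl e
      · exact Or.inr ⟨h, e⟩
    · rintro (rfl | h)
      · exact o.le_refl _
      · exact h.1
  ext a b
  rw [le_iff, le_iff, key]

/-- The ordering with a given positive cone. -/
def ofCone (P : G → Prop) (h1 : ¬ P 1) (hmul : ∀ a b, P a → P b → P (a * b))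
    (htot : ∀ a, a ≠ 1 → P a ∨ P a⁻¹) : LeftOrdering G where
  le a b := a = b ∨ P (a⁻¹ * b)
  le_refl a := Or.inl rfl
  le_trans a b c := by
    rintro (rfl | h) (rfl | h')
    · exact Or.inl rfl
    · exact Or.inr h'
    · exact Or.inr h
    · exact Or.inr (by simpa [mul_assoc] using hmul _ _ h h')
  le_antisymm a b := by
    rintro (rfl | h) (h' | h')
    · rfl
    · rfl
    · exact h'.symm
    · exact absurd (by simpa [mul_assoc] using hmul _ _ h h') h1
  le_total a b := by
    by_cases e : a = b
    · exact Or.inl (Or.inl e)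
    · rcases htot (a⁻¹ * b) (fun h => e (inv_mul_eq_one.1 h)) with h | h
      · exact Or.inl (Or.inr h)
      · exact Or.inr (Or.inr (by simpa using h))
  mul_le_mul_left a b c := by
    rintro (rfl | h)
    · exact Or.inl rfl
    · exact Or.inr (by simpa [mul_assoc] using h)

theorem pos_ofCone {P : G → Prop} {h1 : ¬ P 1} {hmul : ∀ a b, P a → P b → P (a * b)}
    {htot : ∀ a, a ≠ 1 → P a ∨ P a⁻¹} {g : G} : (ofCone P h1 hmul htot).Pos g ↔ P g := by
  constructor
  · rintro ⟨h | h, h'⟩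
    · exact absurd h h'
    · simpa using h
  · intro h
    exact ⟨Or.inr (by simpa using h), fun e => h1 (e ▸ h)⟩

theorem pos_restrict (o : LeftOrdering G) {H : Subgroup G} {x : H} :
    (o.restrict H).Pos x ↔ o.Pos x := by
  constructor
  · exact fun h => ⟨h.1, fun e => h.2 (Subtype.ext e)⟩
  · exact fun h => ⟨h.1, fun e => h.2 (congrArg Subtype.val e)⟩

/-- The linear order underlying an ordering. -/
@[reducible] noncomputable def toLinearOrder (o : LeftOrdering G) : LinearOrder G where
  le := o.le
  lt := o.lt
  le_refl := o.le_refl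
  le_trans := o.le_trans
  le_antisymm := o.le_antisymm
  le_total := o.le_total
  lt_iff_le_not_ge a b :=
    ⟨fun h => ⟨h.1, fun h' => h.2 (o.le_antisymm _ _ h.1 h')⟩,
      fun h => ⟨h.1, fun e => h.2 (e ▸ o.le_refl _)⟩⟩
  toDecidableLE := Classical.decRel _

theorem mulLeftMono (o : LeftOrdering G) :
    letI := o.toLinearOrder
    MulLeftMono G :=
  let _ := o.toLinearOrder
  ⟨fun c a b h => o.mul_le_mul_left a b c h⟩

theorem isConvex_subgroup_iff (o : LeftOrdering G) {H : Subgroup G} :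
    o.IsConvex (H : Set G) ↔ ∀ x y, y ∈ H → o.Pos x → o.Pos (x⁻¹ * y) → x ∈ H := by
  constructor
  · intro h x y hy hx hxy
    exact h 1 H.one_mem y hy x hx (o.lt_iff_pos.2 hxy)
  · intro h a ha b hb f haf hfb
    have := h (a⁻¹ * f) (a⁻¹ * b) (H.mul_mem (H.inv_mem ha) hb) (o.lt_iff_pos.1 haf)
      (by simpa [mul_assoc] using o.lt_iff_pos.1 hfb)
    simpa using H.mul_mem ha this

/-- The coset `gH` of a convex subgroup lies on one side of `1`. -/
theorem IsConvex.pos_mul {o : LeftOrdering G} {H : Subgroup G} (hH : o.IsConvex (H : Set G))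
    {g h : G} (hg : g ∉ H) (hh : h ∈ H) (hpos : o.Pos g) : o.Pos (g * h) := by
  by_contra hn
  have hne : g * h ≠ 1 := fun e => hg (by rw [eq_inv_of_mul_eq_one_left e]; exact H.inv_mem hh)
  have h1 := o.pos_inv_of_not hne hn
  rw [mul_inv_rev] at h1
  refine hg (H.inv_mem_iff.1 (hH h hh 1 H.one_mem g⁻¹ (o.lt_iff_pos.2 h1) (o.lt_iff_pos.2 ?_)))
  simpa using hpos

/-- The coset `Hg` of a convex subgroup lies on one side of `1`. -/
theorem IsConvex.mul_pos {o : LeftOrdering G} {H : Subgroup G} (hH : o.IsConvex (H : Set G))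
    {g h : G} (hg : g ∉ H) (hh : h ∈ H) (hpos : o.Pos g) : o.Pos (h * g) := by
  by_contra hn
  have hne : h * g ≠ 1 := fun e => hg (by rw [eq_inv_of_mul_eq_one_right e]; exact H.inv_mem hh)
  have h1 := o.pos_inv_of_not hne hn
  rw [mul_inv_rev] at h1
  exact hg (hH 1 H.one_mem h⁻¹ (H.inv_mem hh) g hpos (o.lt_iff_pos.2 h1))

theorem isConvex_bot (o : LeftOrdering G) : o.IsConvex ((⊥ : Subgroup G) : Set G) :=
  o.isConvexConradian_bot.1

theorem isConvex_top (o : LeftOrdering G) : o.IsConvex ((⊤ : Subgroup G) : Set G) :=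
  fun _ _ _ _ _ _ _ => Subgroup.mem_top _

theorem IsConvex.mem_of_pow_mem {o : LeftOrdering G} {H : Subgroup G}
    (hH : o.IsConvex (H : Set G)) {g : G} {n : ℕ} (hn : 0 < n) (h : g ^ n ∈ H) : g ∈ H := by
  have key : ∀ g : G, o.Pos g → g ^ n ∈ H → g ∈ H := by
    intro g hg h
    rcases Nat.lt_or_ge 1 n with h1 | h1
    · refine o.isConvex_subgroup_iff.1 hH g _ h hg ?_
      obtain ⟨k, rfl⟩ : ∃ k, n = k + 1 := ⟨n - 1, by omega⟩
      rw [pow_succ', inv_mul_cancel_left]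
      exact hg.pow (by omega)
    · obtain rfl : n = 1 := by omega
      simpa using h
  rcases eq_or_ne g 1 with rfl | h1
  · exact H.one_mem
  · rcases o.pos_or h1 with hp | hp
    · exact key g hp h
    · exact H.inv_mem_iff.1 (key _ hp (by rw [inv_pow]; exact H.inv_mem h))

theorem IsConvex.map_subtype {o : LeftOrdering G} {N : Subgroup G} (hN : o.IsConvex (N : Set G))
    {H : Subgroup N} (hH : (o.restrict N).IsConvex (H : Set N)) :
    o.IsConvex (H.map N.subtype : Set G) := by
  rw [isConvex_subgroup_iff] at hH ⊢
  rintro x _ ⟨y, hy, rfl⟩ hx hxy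
  have hxN : x ∈ N := o.isConvex_subgroup_iff.1 hN x y y.2 hx hxy
  exact ⟨⟨x, hxN⟩, hH _ y hy (o.pos_restrict.2 hx) (o.pos_restrict.2 hxy), rfl⟩

theorem IsConvex.subgroupOf {o : LeftOrdering G} {H : Subgroup G} (hH : o.IsConvex (H : Set G))
    (N : Subgroup G) : (o.restrict N).IsConvex (H.subgroupOf N : Set N) := by
  rw [isConvex_subgroup_iff] at hH ⊢
  intro x y hy hx hxy
  exact hH x y hy (o.pos_restrict.1 hx) (o.pos_restrict.1 hxy)

/-! ### Isolated orderings -/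

/-- `o` is the only ordering for which all elements of the finite set `F` are positive. -/
structure IsolatedBy (o : LeftOrdering G) (F : Finset G) : Prop where
  pos : ∀ f ∈ F, o.Pos f
  eq : ∀ o' : LeftOrdering G, (∀ f ∈ F, o'.Pos f) → o' = o

/-- Finite intersections of subbasic sets form a basis, so openness of a point amounts to finitely
many sign conditions. -/
theorem exists_isolatedBy_of_isOpen {o : LeftOrdering G}
    (ho : IsOpen ({o} : Set (LeftOrdering G))) : ∃ F, o.IsolatedBy F := by
  classical
  obtain ⟨_, ⟨f, ⟨hfin, hsub⟩, rfl⟩, hof, hfo⟩ :=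
    (TopologicalSpace.isTopologicalBasis_of_subbasis
      (rfl : (instTopologicalSpace : TopologicalSpace (LeftOrdering G)) = _)).isOpen_iff.1 ho o rfl
  choose! φ hφ using fun U (hU : U ∈ f) => hsub hU
  refine ⟨hfin.toFinset.image φ, ?_, ?_⟩
  · intro x hx
    obtain ⟨U, hU, rfl⟩ := Finset.mem_image.1 hx
    rw [Set.Finite.mem_toFinset] at hU
    have := Set.mem_sInter.1 hof U hU
    rw [(hφ U hU).2] at this
    exact this
  · intro o' h
    refine hfo (Set.mem_sInter.2 fun U hU => ?_)
    rw [(hφ U hU).2]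
    exact h _ (Finset.mem_image_of_mem _ (hfin.mem_toFinset.2 hU))

/-- Reversing an ordering on the complement `E \ D` of a convex subgroup in a larger one. -/
theorem exists_flip (o : LeftOrdering G) {D E : Subgroup G} (hD : o.IsConvex (D : Set G))
    (hE : o.IsConvex (E : Set G)) :
    ∃ o' : LeftOrdering G, ∀ g, o'.Pos g ↔
      (g ∈ E ∧ g ∉ D ∧ o.Pos g⁻¹) ∨ (¬ (g ∈ E ∧ g ∉ D) ∧ o.Pos g) := by
  refine ⟨ofCone _ ?_ ?_ ?_, fun g => pos_ofCone⟩
  · simp [o.not_pos_one]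
  · have hinv : ∀ {x}, x ∉ D → x⁻¹ ∉ D := fun h h' => h (D.inv_mem_iff.1 h')
    -- A factor in `D` does not change the sign of an element of `E \ D`, and a factor in `E` does
    -- not change the sign of an element outside `E`.
    rintro a b (⟨haE, haD, ha⟩ | ⟨ha', ha⟩) (⟨hbE, hbD, hb⟩ | ⟨hb', hb⟩)
    · refine Or.inl ⟨E.mul_mem haE hbE, fun h => hinv hbD ?_, by simpa using hb.mul ha⟩
      refine o.isConvex_subgroup_iff.1 hD b⁻¹ (a * b)⁻¹ (D.inv_mem h) hb ?_
      simpa [mul_assoc] using ha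
    · by_cases hbE : b ∈ E
      · have hbD : b ∈ D := by_contra fun h => hb' ⟨hbE, h⟩
        refine Or.inl ⟨E.mul_mem haE hbE, fun h => haD ((D.mul_mem_cancel_right hbD).1 h), ?_⟩
        rw [mul_inv_rev]
        exact hD.mul_pos (hinv haD) (D.inv_mem hbD) ha
      · exact Or.inr ⟨fun h => hbE ((E.mul_mem_cancel_left haE).1 h.1), hE.mul_pos hbE haE hb⟩
    · by_cases haE : a ∈ E
      · have haD : a ∈ D := by_contra fun h => ha' ⟨haE, h⟩
        refine Or.inl ⟨E.mul_mem haE hbE, fun h => hbD ((D.mul_mem_cancel_left haD).1 h), ?_⟩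
        rw [mul_inv_rev]
        exact hD.pos_mul (hinv hbD) (D.inv_mem haD) hb
      · exact Or.inr ⟨fun h => haE ((E.mul_mem_cancel_right hbE).1 h.1), hE.pos_mul haE hbE ha⟩
    · refine Or.inr ⟨fun ⟨h1, h2⟩ => ?_, ha.mul hb⟩
      have haE : a ∈ E := o.isConvex_subgroup_iff.1 hE a _ h1 ha (by simpa using hb)
      have hbE : b ∈ E := (E.mul_mem_cancel_left haE).1 h1
      exact h2 (D.mul_mem (by_contra fun h => ha' ⟨haE, h⟩) (by_contra fun h => hb' ⟨hbE, h⟩))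
  · intro a ha
    rcases o.pos_or ha with h | h <;> by_cases h' : a ∈ E ∧ a ∉ D
    · exact Or.inr (Or.inl (by simpa using And.intro h'.1 ⟨h'.2, h⟩))
    · exact Or.inl (Or.inr ⟨h', h⟩)
    · exact Or.inl (Or.inl ⟨h'.1, h'.2, h⟩)
    · exact Or.inr (Or.inr ⟨by simpa using h', h⟩)

/-- Extending an ordering on a convex subgroup. -/
theorem exists_extend (o : LeftOrdering G) {C : Subgroup G} (hC : o.IsConvex (C : Set G))
    (o' : LeftOrdering C) : ∃ o'' : LeftOrdering G, ∀ g, o''.Pos g ↔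
      (∃ h : g ∈ C, o'.Pos ⟨g, h⟩) ∨ (g ∉ C ∧ o.Pos g) := by
  refine ⟨ofCone _ ?_ ?_ ?_, fun g => pos_ofCone⟩
  · rintro (⟨_, h⟩ | ⟨h, _⟩)
    · exact o'.not_pos_one h
    · exact h C.one_mem
  · rintro a b (⟨haC, ha⟩ | ⟨haC, ha⟩) (⟨hbC, hb⟩ | ⟨hbC, hb⟩)
    · exact Or.inl ⟨C.mul_mem haC hbC, ha.mul hb⟩
    · exact Or.inr ⟨fun h => hbC ((C.mul_mem_cancel_left haC).1 h), hC.mul_pos hbC haC hb⟩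
    · exact Or.inr ⟨fun h => haC ((C.mul_mem_cancel_right hbC).1 h), hC.pos_mul haC hbC ha⟩
    · exact Or.inr ⟨fun h => haC (o.isConvex_subgroup_iff.1 hC a _ h ha (by simpa using hb)),
        ha.mul hb⟩
  · intro a ha
    by_cases haC : a ∈ C
    · rcases o'.pos_or (g := ⟨a, haC⟩) (fun e => ha (congrArg Subtype.val e)) with h | h
      · exact Or.inl (Or.inl ⟨haC, h⟩)
      · exact Or.inr (Or.inl ⟨C.inv_mem haC, h⟩)
    · rcases o.pos_or ha with h | h
      · exact Or.inl (Or.inr ⟨haC, h⟩)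
      · exact Or.inr (Or.inr ⟨fun h' => haC (C.inv_mem_iff.1 h'), h⟩)

/-- A rival ordering on `C` extends to the group by keeping `o` outside `C`, and would give a rival
of `o`. -/
theorem IsolatedBy.restrict {o : LeftOrdering G} {F : Finset G} (h : o.IsolatedBy F)
    {C : Subgroup G} (hC : o.IsConvex (C : Set G)) [DecidablePred (· ∈ C)] :
    (o.restrict C).IsolatedBy (F.subtype (· ∈ C)) := by
  refine ⟨fun f hf => o.pos_restrict.2 (h.pos _ (Finset.mem_subtype.1 hf)), fun o' ho' => ?_⟩
  obtain ⟨o'', ho''⟩ := o.exists_extend hC o'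
  have e := h.eq o'' fun f hf => by
    rw [ho'']
    by_cases hfC : f ∈ C
    · exact Or.inl ⟨hfC, ho' _ (Finset.mem_subtype.2 hf)⟩
    · exact Or.inr ⟨hfC, h.pos _ hf⟩
  refine eq_of_pos_imp fun g hg => ?_
  have := o.pos_restrict.1 hg
  rw [← e, ho''] at this
  rcases this with ⟨_, h⟩ | ⟨h, _⟩
  · exact h
  · exact absurd g.2 h

/-- The ordering induced on the quotient by a convex normal subgroup. -/
theorem exists_quotient (o : LeftOrdering G) {N : Subgroup G} [N.Normal]
    (hN : o.IsConvex (N : Set G)) :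
    ∃ o' : LeftOrdering (G ⧸ N), ∀ g : G, o'.Pos (g : G ⧸ N) ↔ g ∉ N ∧ o.Pos g := by
  have hcong : ∀ g g' : G, (g : G ⧸ N) = g' → g ∉ N → o.Pos g → g' ∉ N ∧ o.Pos g' := by
    intro g g' e hg hp
    rw [QuotientGroup.eq] at e
    have : g' = g * (g⁻¹ * g') := by group
    rw [this]
    exact ⟨fun h => hg ((N.mul_mem_cancel_right e).1 h), hN.pos_mul hg e hp⟩
  refine ⟨ofCone (fun q => ∃ g : G, (g : G ⧸ N) = q ∧ g ∉ N ∧ o.Pos g) ?_ ?_ ?_, fun g => ?_⟩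
  · rintro ⟨g, e, hg, -⟩
    exact hg ((QuotientGroup.eq_one_iff g).1 e)
  · rintro _ _ ⟨a, rfl, haN, ha⟩ ⟨b, rfl, hbN, hb⟩
    exact ⟨a * b, rfl, fun h => haN (o.isConvex_subgroup_iff.1 hN a _ h ha (by simpa using hb)),
      ha.mul hb⟩
  · intro q hq
    induction q using QuotientGroup.induction_on with
    | H g =>
      have hg : g ∉ N := fun h => hq ((QuotientGroup.eq_one_iff g).2 h)
      rcases o.pos_or (fun e : g = 1 => hg (e ▸ N.one_mem)) with h | h
      · exact Or.inl ⟨g, rfl, hg, h⟩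
      · exact Or.inr ⟨g⁻¹, rfl, fun h' => hg (N.inv_mem_iff.1 h'), h⟩
  · rw [pos_ofCone]
    constructor
    · rintro ⟨g', e, hg', h⟩
      exact hcong g' g e hg' h
    · exact fun h => ⟨g, rfl, h⟩

/-- A rival of `o'` lifts to the group, with `o` deciding on `N`, and the lift is positive on `F`.
-/
theorem IsolatedBy.quotient {o : LeftOrdering G} {F : Finset G} (h : o.IsolatedBy F)
    {N : Subgroup G} [N.Normal] {o' : LeftOrdering (G ⧸ N)}
    (ho' : ∀ g : G, o'.Pos (g : G ⧸ N) ↔ g ∉ N ∧ o.Pos g) :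
    ∃ F' : Finset (G ⧸ N), o'.IsolatedBy F' := by
  classical
  refine ⟨(F.filter (· ∉ N)).image (fun g : G => (g : G ⧸ N)), ?_, fun p hp => ?_⟩
  · intro q hq
    obtain ⟨f, hf, rfl⟩ := Finset.mem_image.1 hq
    rw [Finset.mem_filter] at hf
    exact (ho' f).2 ⟨hf.2, h.pos f hf.1⟩
  · have hcone : ∃ r : LeftOrdering G, ∀ g, r.Pos g ↔ p.Pos (g : G ⧸ N) ∨ (g ∈ N ∧ o.Pos g) := by
      have h1 : ∀ {g : G}, g ∈ N → (g : G ⧸ N) = 1 := fun hg => (QuotientGroup.eq_one_iff _).2 hg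
      refine ⟨ofCone _ ?_ ?_ ?_, fun g => pos_ofCone⟩
      · rintro (h | ⟨_, h⟩)
        · exact p.not_pos_one h
        · exact o.not_pos_one h
      · rintro a b (ha | ⟨haN, ha⟩) (hb | ⟨hbN, hb⟩)
        · exact Or.inl (ha.mul hb)
        · exact Or.inl (by rw [QuotientGroup.mk_mul, h1 hbN, mul_one]; exact ha)
        · exact Or.inl (by rw [QuotientGroup.mk_mul, h1 haN, one_mul]; exact hb)
        · exact Or.inr ⟨N.mul_mem haN hbN, ha.mul hb⟩
      · intro g hg
        by_cases hgN : g ∈ N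
        · rcases o.pos_or hg with h | h
          · exact Or.inl (Or.inr ⟨hgN, h⟩)
          · exact Or.inr (Or.inr ⟨N.inv_mem hgN, h⟩)
        · rcases p.pos_or (fun e => hgN ((QuotientGroup.eq_one_iff g).1 e)) with h | h
          · exact Or.inl (Or.inl h)
          · exact Or.inr (Or.inl h)
    obtain ⟨r, hr⟩ := hcone
    have e := h.eq r fun f hf => by
      rw [hr]
      by_cases hfN : f ∈ N
      · exact Or.inr ⟨hfN, h.pos f hf⟩
      · exact Or.inl (hp _ (Finset.mem_image_of_mem _ (Finset.mem_filter.2 ⟨hf, hfN⟩)))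
    refine eq_of_pos_imp fun q hq => ?_
    induction q using QuotientGroup.induction_on with
    | H g =>
      obtain ⟨hgN, hg⟩ := (ho' g).1 hq
      rw [← e, hr] at hg
      exact hg.resolve_right fun h' => hgN h'.1

/-- An isolating set meets the difference of two convex subgroups. -/
theorem IsolatedBy.exists_mem_diff {o : LeftOrdering G} {F : Finset G} (h : o.IsolatedBy F)
    {D E : Subgroup G} (hD : o.IsConvex (D : Set G)) (hE : o.IsConvex (E : Set G)) (hDE : D < E) :
    ∃ f ∈ F, f ∈ E ∧ f ∉ D := by
  by_contra! hF
  obtain ⟨o', ho'⟩ := o.exists_flip hD hE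
  have e := h.eq o' fun f hf => (ho' f).2 (Or.inr ⟨fun h' => h'.2 (hF f hf h'.1), h.pos f hf⟩)
  obtain ⟨g, hgE, hgD, hg⟩ := o.exists_pos_of_not_le hDE.not_ge
  have hg' : o'.Pos g := e ▸ hg
  rcases (ho' g).1 hg' with ⟨_, _, h1⟩ | ⟨h1, _⟩
  · exact Pos.not_inv hg h1
  · exact h1 ⟨hgE, hgD⟩

/-- Convex subgroups form a chain whose members are separated by `F`, so `H ↦ F ∩ H` is injective on
them. -/
theorem IsolatedBy.finite_convex {o : LeftOrdering G} {F : Finset G} (h : o.IsolatedBy F) :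
    {H : Subgroup G | o.IsConvex (H : Set G)}.Finite := by
  classical
  refine Set.Finite.of_finite_image (f := fun H => F.filter (· ∈ H))
    (F.powerset.finite_toSet.subset ?_) ?_
  · rintro _ ⟨H, _, rfl⟩
    exact Finset.mem_coe.2 (Finset.mem_powerset.2 (Finset.filter_subset _ _))
  · intro D hD E hE e
    have key : ∀ D E : Subgroup G, o.IsConvex (D : Set G) → o.IsConvex (E : Set G) →
        F.filter (· ∈ D) = F.filter (· ∈ E) → D ≤ E → D = E := by
      intro D E hD hE e hDE
      by_contra hne
      obtain ⟨f, hf, hfE, hfD⟩ := h.exists_mem_diff hD hE (lt_of_le_of_ne hDE hne)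
      have : f ∈ F.filter (· ∈ E) := Finset.mem_filter.2 ⟨hf, hfE⟩
      rw [← e] at this
      exact hfD (Finset.mem_filter.1 this).2
    rcases IsConvex.le_total hD hE with h' | h'
    · exact key D E hD hE e h'
    · exact (key E D hE hD e.symm h').symm

/-- A proper convex subgroup that is contained in no other. -/
structure IsMaxConvex (o : LeftOrdering G) (N : Subgroup G) : Prop where
  convex : o.IsConvex (N : Set G)
  ne_top : N ≠ ⊤
  eq_top : ∀ H : Subgroup G, o.IsConvex (H : Set G) → N < H → H = ⊤

theorem IsMaxConvex.eq_top_of_not_mem {o : LeftOrdering G} {N : Subgroup G}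
    (hN : o.IsMaxConvex N) {H : Subgroup G} (hH : o.IsConvex (H : Set G)) {x : G} (hx : x ∉ N)
    (hxH : x ∈ H) : H = ⊤ := by
  rcases hN.convex.le_total hH with h | h
  · exact hN.eq_top H hH (lt_of_le_of_ne h fun e => hx (e ▸ hxH))
  · exact absurd (h hxH) hx

theorem IsolatedBy.exists_isMaxConvex {o : LeftOrdering G} [Nontrivial G] {F : Finset G}
    (h : o.IsolatedBy F) : ∃ N, o.IsMaxConvex N := by
  have hfin : {H : Subgroup G | o.IsConvex (H : Set G) ∧ H ≠ ⊤}.Finite :=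
    h.finite_convex.subset fun _ h => h.1
  obtain ⟨N, hN⟩ := hfin.exists_maximal ⟨⊥, o.isConvex_bot, bot_ne_top⟩
  refine ⟨N, hN.1.1, hN.1.2, fun H hH hlt => ?_⟩
  by_contra hne
  exact hlt.not_ge (hN.2 ⟨hH, hne⟩ hlt.le)

end LeftOrdering

section Conrad

variable {G : Type*} [Group G]

/-! ### Powers of a positive element in a Conradian ordering -/

variable [LinearOrder G] [MulLeftMono G]

/-- Conjugating by `w` moves the Conradian condition from the base point `1` to the base point `w`.
-/
theorem exists_lt_mul_pow_mul (hC : ∀ f g : G, 1 < f → 1 < g → ∃ n : ℕ, g < f * g ^ n)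
    {f g w : G} (hf : w < f * w) (hg : w < g * w) : ∃ n : ℕ, g * w < f * (g ^ n * w) := by
  have conj : ∀ x, w < x * w → 1 < w⁻¹ * x * w := fun x hx => by
    rw [mul_assoc, lt_inv_mul_iff_mul_lt, mul_one]
    exact hx
  obtain ⟨n, hn⟩ := hC _ _ (conj f hf) (conj g hg)
  refine ⟨n, ?_⟩
  have := mul_lt_mul_right hn w
  have e : (w⁻¹ * g * w) ^ n = w⁻¹ * g ^ n * w := by
    simpa using conj_pow (a := w⁻¹) (b := g) (i := n)
  rw [e] at this
  simpa [mul_assoc] using this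

theorem exists_mul_pow_lt_pow (hC : ∀ f g : G, 1 < f → 1 < g → ∃ n : ℕ, g < f * g ^ n)
    {f h : G} (hf : 1 < f) {s : ℕ} (hs : 1 < f ^ (s + 1) * h⁻¹) (n : ℕ) :
    ∃ m : ℕ, h * f ^ n < f ^ m := by
  obtain ⟨j, hj⟩ := hC (f ^ (s + 1) * h⁻¹) (f ^ (s + 1 + n)) hs
    (one_lt_pow' hf (by omega))
  refine ⟨(s + 1 + n) * j, ?_⟩
  have := mul_lt_mul_right hj (h * (f ^ (s + 1))⁻¹)
  rw [pow_add, ← pow_add, pow_mul] at *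
  simpa [mul_assoc, pow_add] using this

/-- Otherwise, with `w = (f ^ m)⁻¹`, both `w * h` and `w * h * w` move `w` upwards. The Conradian
condition at `w` then makes some `(w * h) ^ n * w` greater than `1`, although `w * h` and `w` are
both below `1`. -/
theorem exists_mul_inv_pow_le_one (hC : ∀ f g : G, 1 < f → 1 < g → ∃ n : ℕ, g < f * g ^ n)
    {f h : G} {m : ℕ} (hm : h < f ^ m) : ∃ s : ℕ, h * (f⁻¹) ^ s ≤ 1 := by
  by_contra! H
  have key : ∀ s : ℕ, (f ^ m)⁻¹ < (f ^ m)⁻¹ * (h * (f⁻¹) ^ s) := fun s => by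
    simpa using mul_lt_mul_right (H s) (f ^ m)⁻¹
  set w := (f ^ m)⁻¹ with hw
  have e1 : (f⁻¹) ^ m = w := by rw [hw, inv_pow]
  have e2 : (f⁻¹) ^ (m + m) = w * w := by rw [pow_add, e1]
  have h1 : w < (w * h) * w := by simpa [mul_assoc, e1] using key m
  have h2 : w < (w * h * w) * w := by simpa [mul_assoc, e2] using key (m + m)
  obtain ⟨n, hn⟩ := exists_lt_mul_pow_mul hC h2 h1
  have h3 : 1 < (w * h) ^ n * w := by
    rw [mul_assoc (w * h) w, mul_lt_mul_iff_left] at hn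
    simpa using mul_lt_mul_right hn w⁻¹
  have h4 : w * h < 1 := by
    simpa [hw] using mul_lt_mul_right hm w
  have hw1 : w < 1 := by
    have := key 0
    have h0 := H 0
    have : 1 < h := by simpa using h0
    rw [hw, Left.inv_lt_one_iff]
    exact this.trans hm
  have h5 : ∀ n : ℕ, (w * h) ^ n * w ≤ 1 := by
    intro n
    induction n with
    | zero => simpa using hw1.le
    | succ n ih =>
      rw [pow_succ', mul_assoc]
      calc (w * h) * ((w * h) ^ n * w) ≤ (w * h) * 1 := mul_le_mul_right ih _
        _ ≤ 1 := by simpa using h4.le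
  exact absurd h3 (h5 n).not_gt

/-- The elements bounded, together with their inverses, by powers of `f`. -/
def powHull (hC : ∀ f g : G, 1 < f → 1 < g → ∃ n : ℕ, g < f * g ^ n) (f : G) (hf : 1 < f) :
    Subgroup G :=
  have hmul : ∀ {x y : G}, (∃ n : ℕ, x < f ^ n) → (∃ n : ℕ, y < f ^ n) →
      ∃ n : ℕ, x * y < f ^ n := by
    rintro x y ⟨m, hm⟩ ⟨n, hn⟩
    obtain ⟨s, hs⟩ := exists_mul_inv_pow_le_one hC hm
    -- The exponent `s` gives only a weak inequality; one more factor `f` makes it strict.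
    have h1 : 1 < f ^ (s + 1) * x⁻¹ := by
      have h2 : (f⁻¹) ^ s ≤ x⁻¹ := by simpa using mul_le_mul_right hs x⁻¹
      have h3 : 1 ≤ f ^ s * x⁻¹ := by simpa using mul_le_mul_right h2 (f ^ s)
      rw [pow_succ', mul_assoc]
      exact one_lt_mul_of_lt_of_le' hf h3
    obtain ⟨k, hk⟩ := exists_mul_pow_lt_pow hC hf h1 n
    exact ⟨k, (mul_lt_mul_right hn x).trans hk⟩
  { carrier := {x | (∃ n : ℕ, x < f ^ n) ∧ ∃ n : ℕ, x⁻¹ < f ^ n}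
    mul_mem' := fun {x y} hx hy => ⟨hmul hx.1 hy.1, by rw [mul_inv_rev]; exact hmul hy.2 hx.2⟩
    one_mem' := ⟨⟨1, by simpa using hf⟩, ⟨1, by simpa using hf⟩⟩
    inv_mem' := fun {x} hx => ⟨hx.2, by simpa using hx.1⟩ }

/-- Hölder's theorem on commutativity. -/
theorem mul_comm_of_archimedean [MulRightMono G]
    (harch : ∀ x y : G, 1 < y → ∃ n : ℕ, x < y ^ n) (a b : G) : a * b = b * a := by
  have near : ∀ x : G, 1 < x → ∀ a : G, ∃ m : ℤ, x ^ m ≤ a ∧ a < x ^ (m + 1) := by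
    intro x hx a
    have hmono : StrictMono fun n : ℤ => x ^ n := by
      intro i j hij
      obtain ⟨k, hk⟩ := Int.eq_ofNat_of_zero_le (sub_nonneg.2 hij.le)
      have e : x ^ j = x ^ i * x ^ k := by
        rw [← zpow_natCast, ← zpow_add]
        congr 1
        omega
      change x ^ i < x ^ j
      rw [e]
      exact lt_mul_of_one_lt_right' _ (one_lt_pow' hx (by omega))
    obtain ⟨n, hn⟩ := harch a x hx
    obtain ⟨k, hk⟩ := harch a⁻¹ x hx
    obtain ⟨m, hm, hmax⟩ := Int.exists_greatest_of_bdd (P := fun m : ℤ => x ^ m ≤ a)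
      ⟨n, fun z hz => by
        by_contra! h
        have := hmono h
        simp only [zpow_natCast] at this
        exact absurd (hn.trans this) hz.not_gt⟩
      ⟨-k, by
        rw [zpow_neg, zpow_natCast]
        exact inv_le_of_inv_le' hk.le⟩
    refine ⟨m, hm, ?_⟩
    by_contra! h
    have := hmax _ h
    omega
  have key : ∀ a b : G, ¬ b * a < a * b := by
    intro a b hlt
    have hc : 1 < a * b * (b * a)⁻¹ := by
      simpa using mul_lt_mul_left hlt (b * a)⁻¹
    set c := a * b * (b * a)⁻¹ with hcdef
    have hcab : a * b = c * (b * a) := by simp [hcdef, mul_assoc]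
    -- Rounding `a` and `b` to powers of such an `x` costs less than `x * x`, which contradicts `a *
    -- b = c * (b * a)`. If there is no such `x`, then `c` is the least positive element, since for
    -- `1 < y < c` the smaller of `y` and `y⁻¹ * c` would qualify; the group is then cyclic.
    by_cases hx : ∃ x : G, 1 < x ∧ x * x ≤ c
    · obtain ⟨x, hx1, hxc⟩ := hx
      obtain ⟨m, hm, hm'⟩ := near x hx1 a
      obtain ⟨n, hn, hn'⟩ := near x hx1 b
      have h1 : a * b < x ^ (m + 1) * x ^ (n + 1) := mul_lt_mul_of_lt_of_lt hm' hn'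
      have h2 : x * x * (x ^ n * x ^ m) ≤ c * (b * a) := mul_le_mul' hxc (mul_le_mul' hn hm)
      have e : x ^ (m + 1) * x ^ (n + 1) = x * x * (x ^ n * x ^ m) := by group
      rw [e, hcab] at h1
      exact absurd h1 h2.not_gt
    · push Not at hx
      have hleast : ∀ y : G, 1 ≤ y → y < c → y = 1 := by
        intro y hy hyc
        by_contra hne
        have hy1 : 1 < y := lt_of_le_of_ne hy (Ne.symm hne)
        have hz : 1 < y⁻¹ * c := by rwa [lt_inv_mul_iff_mul_lt, mul_one]
        have e : y * (y⁻¹ * c) = c := by group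
        rcases le_total y (y⁻¹ * c) with h | h
        · have := mul_le_mul_right h y
          rw [e] at this
          exact absurd (hx y hy1) this.not_gt
        · have := mul_le_mul_left h (y⁻¹ * c)
          rw [e] at this
          exact absurd (hx _ hz) this.not_gt
      have hpow : ∀ a : G, ∃ m : ℤ, a = c ^ m := by
        intro a
        obtain ⟨m, hm, hm'⟩ := near c hc a
        refine ⟨m, ?_⟩
        have h1 : 1 ≤ (c ^ m)⁻¹ * a := by simpa using hm
        have h2 : (c ^ m)⁻¹ * a < c := by
          have := mul_lt_mul_right hm' (c ^ m)⁻¹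
          have e : (c ^ m)⁻¹ * c ^ (m + 1) = c := by group
          rwa [e] at this
        exact (inv_mul_eq_one.1 (hleast _ h1 h2)).symm
      obtain ⟨m, hm⟩ := hpow a
      obtain ⟨n, hn⟩ := hpow b
      have : a * b = b * a := by rw [hm, hn, ← zpow_add, ← zpow_add, add_comm]
      exact absurd hlt (by rw [this]; exact lt_irrefl _)
  exact le_antisymm (not_lt.1 (key a b)) (not_lt.1 (key b a))

end Conrad

namespace LeftOrdering

variable {G : Type*} [Group G]

/-! ### Non-triviality of the Conradian soul -/

theorem lt_mul_right_of_conj {o : LeftOrdering G} {s : G}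
    (hs : ∀ g, o.Pos g → o.Pos (s⁻¹ * g * s)) {a b : G} (h : o.lt a b) : o.lt (a * s) (b * s) := by
  rw [lt_iff_pos] at h ⊢
  simpa [mul_assoc] using hs _ h

/-- An isolated ordering is invariant under conjugation by the elements of some non-trivial convex
subgroup. -/
theorem IsolatedBy.exists_convex_invariant [Nontrivial G] {o : LeftOrdering G} {F : Finset G}
    (h : o.IsolatedBy F) : ∃ C : Subgroup G, C ≠ ⊥ ∧ o.IsConvex (C : Set G) ∧
      ∀ x ∈ C, ∀ g, o.Pos g → o.Pos (x⁻¹ * g * x) := by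
  let _ := o.toLinearOrder
  have : MulLeftMono G := o.mulLeftMono
  obtain ⟨f₀, hf₀, -⟩ := h.exists_mem_diff o.isConvex_bot o.isConvex_top bot_lt_top
  obtain ⟨h₀, hh₀, hmin⟩ := F.exists_min_image id ⟨f₀, hf₀⟩
  have hpos : 1 < h₀ := h.pos h₀ hh₀
  let S : Subgroup G :=
    { carrier := {x | ∀ g, o.Pos g ↔ o.Pos (x⁻¹ * g * x)}
      mul_mem' := fun {x y} hx hy g => by
        rw [hx, hy]
        simp [mul_assoc]
      one_mem' := fun g => by simp
      inv_mem' := fun {x} hx g => by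
        rw [hx (x⁻¹⁻¹ * g * x⁻¹)]
        simp [mul_assoc] }
  have hsmall : ∀ x, 1 ≤ x → x ≤ h₀ → x ∈ S := by
    intro x hx hxh
    let o' : LeftOrdering G := ofCone (fun g => o.Pos (x⁻¹ * g * x)) (by simp [o.not_pos_one])
      (fun a b ha hb => by simpa [mul_assoc] using ha.mul hb)
      (fun a ha => by
        simpa [mul_assoc] using o.pos_or (g := x⁻¹ * a * x) (fun e => ha (by
          have : a = x * (x⁻¹ * a * x) * x⁻¹ := by group
          rw [this, e]; simp)))
    have e : o' = o := h.eq o' fun f hf => pos_ofCone.2 (by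
      have h1 : 1 < f := h.pos f hf
      -- For `x > 1` this is `x ≤ h₀ ≤ f < f * x`, by minimality of `h₀` in `F`.
      have h2 : x < f * x := by
        rcases hx.eq_or_lt with rfl | hx1
        · simpa using h1
        · exact (hxh.trans (hmin f hf)).trans_lt (lt_mul_of_one_lt_right' f hx1)
      rw [mul_assoc]
      exact o.lt_iff_pos.1 h2)
    intro g
    rw [← pos_ofCone (P := fun g => o.Pos (x⁻¹ * g * x))]
    exact (congrArg (fun p : LeftOrdering G => p.Pos g) e).symm.to_iff
  have hpowS : ∀ n : ℕ, h₀ ^ n ∈ S := fun n => S.pow_mem (hsmall h₀ hpos.le le_rfl) n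
  have hbdd : ∀ (n : ℕ) (y : G), 1 ≤ y → y ≤ h₀ ^ n → y ∈ S := by
    intro n
    induction n with
    | zero =>
      intro y hy hy'
      rw [pow_zero] at hy'
      rw [_root_.le_antisymm hy' hy]
      exact S.one_mem
    | succ n ih =>
      intro y hy hy'
      rcases _root_.le_total y h₀ with h1 | h1
      · exact hsmall y hy h1
      · have h2 : h₀⁻¹ * y ∈ S := ih _ (by simpa using h1) (by
          simpa [pow_succ'] using mul_le_mul_right hy' h₀⁻¹)
        simpa using S.mul_mem (hsmall h₀ hpos.le le_rfl) h2
  have hCS : ∀ y : G, (∃ n : ℕ, y < h₀ ^ n ∧ y⁻¹ < h₀ ^ n) → y ∈ S := by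
    rintro y ⟨n, h1, h2⟩
    rcases _root_.le_total 1 y with hy | hy
    · exact hbdd n y hy h1.le
    · exact S.inv_mem_iff.1 (hbdd n _ (by simpa using hy) h2.le)
  have hmono : StrictMono fun n : ℕ => h₀ ^ n := strictMono_nat_of_lt_succ fun n => by
    simpa [pow_succ] using hpos
  -- Right multiplication by `h₀ ^ n` is monotone because `h₀ ^ n` lies in `S`.
  have hmul : ∀ {x y : G} {m n : ℕ}, x < h₀ ^ m → y < h₀ ^ n → x * y < h₀ ^ (m + n) := by
    intro x y m n hx hy
    rw [pow_add]
    exact (mul_lt_mul_right hy x).trans (lt_mul_right_of_conj (fun g => (hpowS n g).1) hx)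
  let C : Subgroup G :=
    { carrier := {y | ∃ n : ℕ, y < h₀ ^ n ∧ y⁻¹ < h₀ ^ n}
      mul_mem' := by
        rintro x y ⟨m, hm, hm'⟩ ⟨n, hn, hn'⟩
        refine ⟨m + n, hmul hm hn, ?_⟩
        rw [mul_inv_rev, add_comm]
        exact hmul hn' hm'
      one_mem' := ⟨1, by simpa using hpos⟩
      inv_mem' := by
        rintro x ⟨m, hm, hm'⟩
        exact ⟨m, hm', by simpa using hm⟩ }
  refine ⟨C, ?_, ?_, fun x hx g => (hCS x hx g).1⟩
  · have hmem : h₀ ∈ C := ⟨2, by simpa using hmono (show 1 < 2 by norm_num), by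
      simpa using (inv_lt_one'.2 hpos).trans (one_lt_pow' hpos two_ne_zero)⟩
    intro e
    rw [e, Subgroup.mem_bot] at hmem
    exact hpos.ne' hmem
  · rw [isConvex_subgroup_iff]
    rintro x y ⟨n, hn, -⟩ hx hxy
    have h1 : x < y := o.lt_iff_pos.2 hxy
    have h2 : 1 < x := hx
    exact ⟨n, h1.trans hn, (inv_lt_one'.2 h2).trans ((h2.trans h1).trans hn)⟩

theorem IsolatedBy.conradianSoul_ne_bot [Nontrivial G] {o : LeftOrdering G} {F : Finset G}
    (h : o.IsolatedBy F) : o.conradianSoul ≠ ⊥ := by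
  obtain ⟨C, hC, hconv, hinv⟩ := h.exists_convex_invariant
  have : C ≤ o.conradianSoul := o.isGreatest_conradianSoul.2
    ⟨hconv, fun f g hf hg => ⟨1, (lt_iff_pos _).2 (pos_restrict _ |>.2 (by
      simpa [mul_assoc] using hinv g g.2 f (o.pos_restrict.1 hf)))⟩⟩
  exact fun e => hC (le_bot_iff.1 (e ▸ this))

/-! ### The maximal convex subgroup of a Conradian ordering -/

/-- The powers of each positive element are unbounded. -/
def IsArch (o : LeftOrdering G) : Prop := ∀ x y, o.Pos y → ∃ n : ℕ, o.lt x (y ^ n)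

/-- The hull of the powers of `f` is a convex subgroup that contains `f ∉ N`, so it is the whole
group. -/
theorem IsMaxConvex.exists_lt_pow {o : LeftOrdering G} (hC : o.IsConradian) {N : Subgroup G}
    (hN : o.IsMaxConvex N) {f : G} (hf : o.Pos f) (hfN : f ∉ N) (x : G) :
    ∃ n : ℕ, o.lt x (f ^ n) := by
  let _ := o.toLinearOrder
  have : MulLeftMono G := o.mulLeftMono
  have hf1 : 1 < f := hf
  have hconv : o.IsConvex (powHull hC f hf : Set G) := by
    rw [isConvex_subgroup_iff]
    rintro a y ⟨⟨n, hn⟩, -⟩ ha hay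
    have h1 : a < y := o.lt_iff_pos.2 hay
    have h2 : 1 < a := ha
    exact ⟨⟨n, h1.trans hn⟩, ⟨0, by simpa using h2⟩⟩
  have htop := hN.eq_top_of_not_mem hconv hfN ⟨⟨2, by
    simpa [pow_two] using hf1⟩, ⟨0, by simpa using hf1⟩⟩
  have : x ∈ powHull hC f hf := htop ▸ Subgroup.mem_top x
  exact this.1

/-- If a positive conjugate `z = g * x * g⁻¹` of `x ∈ N` were outside `N`, its powers would be
cofinal. Some `z ^ n * g = g * x ^ n` would then exceed `g * f`, where `f` is an upper bound of `N`.
-/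
theorem IsMaxConvex.normal {o : LeftOrdering G} (hC : o.IsConradian) {N : Subgroup G}
    (hN : o.IsMaxConvex N) : N.Normal := by
  let _ := o.toLinearOrder
  have : MulLeftMono G := o.mulLeftMono
  obtain ⟨f, -, hfN, hf⟩ := o.exists_pos_of_not_le (fun h => hN.ne_top (top_le_iff.1 h))
  have hbd : ∀ x ∈ N, x < f := by
    intro x hx
    refine (o.lt_iff_pos).2 (hN.convex.mul_pos hfN (N.inv_mem hx) hf)
  have key : ∀ x ∈ N, ∀ g : G, o.Pos (g * x * g⁻¹) → g * x * g⁻¹ ∈ N := by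
    intro x hx g hpos
    by_contra hz
    obtain ⟨a, ha⟩ := hN.exists_lt_pow hC hpos hz (g * f)
    obtain ⟨b, hb⟩ := hN.exists_lt_pow hC hpos hz g⁻¹
    have hb' : g⁻¹ < (g * x * g⁻¹) ^ b := hb
    have ha' : g * f < (g * x * g⁻¹) ^ a := ha
    obtain ⟨s, hs⟩ := exists_mul_inv_pow_le_one hC hb'
    -- The extra exponent `s` absorbs the right factor `g`, which may be negative.
    have h1 : (g * x * g⁻¹) ^ a ≤ (g * x * g⁻¹) ^ (a + s) * g := by
      have h2 : ((g * x * g⁻¹)⁻¹) ^ s ≤ g := by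
        simpa only [mul_inv_cancel_left, mul_one] using mul_le_mul_right hs g
      have h3 : 1 ≤ (g * x * g⁻¹) ^ s * g := by
        simpa only [inv_pow, mul_inv_cancel] using mul_le_mul_right h2 ((g * x * g⁻¹) ^ s)
      rw [pow_add, mul_assoc ((g * x * g⁻¹) ^ a)]
      exact le_mul_of_one_le_right' h3
    have e : (g * x * g⁻¹) ^ (a + s) * g = g * x ^ (a + s) := by
      rw [conj_pow]; group
    rw [e] at h1
    have h2 := ha'.trans_le h1
    have h3 : f < x ^ (a + s) := lt_of_mul_lt_mul_left' h2
    exact absurd (hbd _ (N.pow_mem hx _)) h3.not_gt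
  refine ⟨fun x hx g => ?_⟩
  by_cases h1 : g * x * g⁻¹ = 1
  · rw [h1]; exact N.one_mem
  · rcases o.pos_or h1 with h | h
    · exact key x hx g h
    · have e : (g * x * g⁻¹)⁻¹ = g * x⁻¹ * g⁻¹ := by group
      rw [e] at h
      have := key x⁻¹ (N.inv_mem hx) g h
      rw [← e] at this
      exact N.inv_mem_iff.1 this


/-! ### Archimedean isolated orderings have rank one -/

/-- Conjugation by every element preserves positivity. -/
def IsBiinvariant (o : LeftOrdering G) : Prop := ∀ x g, o.Pos g → o.Pos (x * g * x⁻¹)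

theorem IsArch.eq_top {o : LeftOrdering G} (ha : o.IsArch) {C : Subgroup G}
    (hC : o.IsConvex (C : Set G)) (hne : C ≠ ⊥) : C = ⊤ := by
  obtain ⟨y, hyC, -, hy⟩ := o.exists_pos_of_not_le (fun h => hne (le_bot_iff.1 h))
  have key : ∀ x, o.Pos x → x ∈ C := by
    intro x hx
    obtain ⟨n, hn⟩ := ha x y hy
    exact o.isConvex_subgroup_iff.1 hC x _ (C.pow_mem hyC n) hx (o.lt_iff_pos.1 hn)
  refine top_le_iff.1 fun x _ => ?_
  by_cases h1 : x = 1
  · rw [h1]; exact C.one_mem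
  · rcases o.pos_or h1 with h | h
    · exact key x h
    · exact C.inv_mem_iff.1 (key _ h)

/-- An archimedean ordering has no proper non-trivial convex subgroup, so the one from
`IsolatedBy.exists_convex_invariant` is everything. -/
theorem IsolatedBy.isBiinvariant_of_isArch {o : LeftOrdering G} {F : Finset G}
    (h : o.IsolatedBy F) (ha : o.IsArch) : o.IsBiinvariant := by
  intro x g hg
  have : Nontrivial G := ⟨g, 1, hg.ne_one⟩
  obtain ⟨C, hC, hconv, hinv⟩ := h.exists_convex_invariant
  have := hinv x⁻¹ (by rw [ha.eq_top hconv hC]; exact Subgroup.mem_top _) g hg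
  simpa using this

theorem IsBiinvariant.mulRightMono {o : LeftOrdering G} (hb : o.IsBiinvariant) :
    letI := o.toLinearOrder
    MulRightMono G := by
  refine ⟨fun c a b h => ?_⟩
  by_cases e : a = b
  · rw [e]
    exact o.le_refl _
  · have h1 : o.lt a b := ⟨h, e⟩
    exact (lt_mul_right_of_conj (s := c) (fun g hg => by simpa using hb c⁻¹ g hg) h1).1

theorem IsBiinvariant.mul_comm_of_isArch {o : LeftOrdering G} (hb : o.IsBiinvariant)
    (ha : o.IsArch) (a b : G) : a * b = b * a := by
  let _ := o.toLinearOrder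
  have : MulLeftMono G := o.mulLeftMono
  have : MulRightMono G := hb.mulRightMono
  exact mul_comm_of_archimedean ha a b

/-- An archimedean ordering on a commutative group comes from an embedding in the reals. -/
theorem IsArch.exists_real_hom {A : Type*} [CommGroup A] {o : LeftOrdering A} (ha : o.IsArch) :
    ∃ φ : Additive A →+ ℝ, ∀ a, o.Pos a → 0 < φ (Additive.ofMul a) := by
  let _ : LinearOrder (Additive A) := o.toLinearOrder
  have : IsOrderedAddMonoid (Additive A) :=
    ⟨fun a b h c => by
      rw [add_comm a, add_comm b]
      exact o.mul_le_mul_left a.toMul b.toMul c.toMul h,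
      fun a b h c => o.mul_le_mul_left a.toMul b.toMul c.toMul h⟩
  have : Archimedean (Additive A) := ⟨fun x y hy => by
    obtain ⟨n, hn⟩ := ha x y hy
    exact ⟨n, hn.1⟩⟩
  obtain ⟨φ, hφ⟩ := Archimedean.exists_orderAddMonoidHom_real_injective (Additive A)
  refine ⟨φ, fun a h => ?_⟩
  have h1 : (0 : Additive A) < Additive.ofMul a := h
  have h2 : StrictMono φ := φ.monotone'.strictMono_of_injective hφ
  have h3 := h2 h1
  rwa [map_zero] at h3

/-- The ordering given by the sign of a real homomorphism, with ties broken by `o`. -/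
theorem exists_lex (o : LeftOrdering G) (φ : Additive G →+ ℝ) :
    ∃ o' : LeftOrdering G, ∀ g, o'.Pos g ↔
      0 < φ (Additive.ofMul g) ∨ (φ (Additive.ofMul g) = 0 ∧ o.Pos g) := by
  refine ⟨ofCone _ ?_ ?_ ?_, fun g => pos_ofCone⟩
  · simp [o.not_pos_one]
  · rintro a b (h | ⟨h, h'⟩) (k | ⟨k, k'⟩) <;> rw [ofMul_mul, map_add]
    · exact Or.inl (by linarith)
    · exact Or.inl (by linarith)
    · exact Or.inl (by linarith)
    · exact Or.inr ⟨by linarith, h'.mul k'⟩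
  · intro a ha
    rw [ofMul_inv, map_neg]
    rcases _root_.lt_trichotomy 0 (φ (Additive.ofMul a)) with h | h | h
    · exact Or.inl (Or.inl h)
    · rcases o.pos_or ha with h' | h'
      · exact Or.inl (Or.inr ⟨h.symm, h'⟩)
      · exact Or.inr (Or.inr ⟨by linarith, h'⟩)
    · exact Or.inr (Or.inl (by linarith))

/-- An isolated ordering is stable under small perturbations of a real homomorphism. -/
theorem IsolatedBy.eventually_pos {o : LeftOrdering G} {F : Finset G} (h : o.IsolatedBy F)
    (π ψ : Additive G →+ ℝ) (hpos : ∀ g, o.Pos g → 0 < π (Additive.ofMul g) ∨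
      (π (Additive.ofMul g) = 0 ∧ 0 < ψ (Additive.ofMul g))) :
    ∀ᶠ ε : ℝ in nhdsWithin 0 (Set.Ioi 0),
      ∀ g, 0 < π (Additive.ofMul g) + ε * ψ (Additive.ofMul g) → o.Pos g := by
  have hF : ∀ᶠ ε : ℝ in nhdsWithin 0 (Set.Ioi 0),
      ∀ f ∈ F, 0 < π (Additive.ofMul f) + ε * ψ (Additive.ofMul f) := by
    rw [Filter.eventually_all_finset]
    intro f hf
    rcases hpos f (h.pos f hf) with h1 | ⟨h1, h2⟩
    · have hc : Continuous fun ε : ℝ => π (Additive.ofMul f) + ε * ψ (Additive.ofMul f) := by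
        fun_prop
      have := hc.tendsto 0
      simp only [zero_mul, add_zero] at this
      exact (this.eventually (lt_mem_nhds h1)).filter_mono nhdsWithin_le_nhds
    · filter_upwards [self_mem_nhdsWithin] with ε hε
      rw [h1, zero_add]
      exact mul_pos hε h2
  filter_upwards [hF] with ε hε g hg
  -- The perturbed homomorphism is positive on `F`, so its lexicographic ordering is `o` itself.
  let χ : Additive G →+ ℝ := π + (AddMonoidHom.mulLeft ε).comp ψ
  obtain ⟨o', ho'⟩ := o.exists_lex χ
  have e := h.eq o' fun f hf => (ho' f).2 (Or.inl (hε f hf))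
  rw [← e]
  exact (ho' g).2 (Or.inl hg)

/-- The additive group of the reals is divisible, hence injective. -/
theorem exists_extend_real {A B : Type*} [AddCommGroup A] [AddCommGroup B] (i : A →+ B)
    (hi : Function.Injective i) (φ : A →+ ℝ) : ∃ ψ : B →+ ℝ, ∀ a, ψ (i a) = φ a := by
  obtain ⟨ψ, hψ⟩ := (Module.Baer.of_divisible (A := ℝ)).extension_property_addMonoidHom i hi φ
  exact ⟨ψ, fun a => DFunLike.congr_fun hψ a⟩

/-- A commutative group with an isolated archimedean ordering has rank one. -/
theorem IsolatedBy.rank_one_of_isArch {A : Type*} [CommGroup A] {o : LeftOrdering A} {F : Finset A}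
    (h : o.IsolatedBy F) (ha : o.IsArch) (x y : A) (hy : y ≠ 1) :
    ∃ (p : ℕ) (q : ℤ), 0 < p ∧ x ^ p * y ^ q = 1 := by
  by_contra! H
  obtain ⟨φ, hφ⟩ := ha.exists_real_hom
  have hφ0 : ∀ a, φ (Additive.ofMul a) = 0 → a = 1 := by
    intro a h0
    by_contra hne
    rcases o.pos_or hne with h1 | h1
    · exact absurd (hφ a h1) (by rw [h0]; exact lt_irrefl _)
    · have := hφ _ h1
      rw [ofMul_inv, map_neg, h0] at this
      simp at this
  set X := Additive.ofMul x with hX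
  set Y := Additive.ofMul y with hY
  have hindep : ∀ m n : ℤ, m • X + n • Y = 0 → m = 0 ∧ n = 0 := by
    intro m n hmn
    have hm : m = 0 := by
      by_contra hm
      have hcase : ∀ m n : ℤ, 0 < m → m • X + n • Y = 0 → False := by
        intro m n hm hmn
        obtain ⟨p, rfl⟩ := Int.eq_ofNat_of_zero_le hm.le
        refine H p n (by omega) ?_
        apply Additive.ofMul.injective
        simpa using hmn
      rcases lt_or_gt_of_ne hm with h1 | h1
      · refine hcase (-m) (-n) (by omega) ?_
        rw [neg_smul, neg_smul, ← neg_add, hmn, neg_zero]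
      · exact hcase m n h1 hmn
    refine ⟨hm, ?_⟩
    rw [hm, zero_smul, zero_add] at hmn
    by_contra hn
    have h1 : n • φ Y = 0 := by rw [← map_zsmul, hmn, map_zero]
    rw [zsmul_eq_mul, mul_eq_zero] at h1
    exact hy (hφ0 y (h1.resolve_left (by exact_mod_cast hn)))
  let i : ℤ × ℤ →+ Additive A :=
    (zmultiplesHom _ X).coprod (zmultiplesHom _ Y)
  have hi_apply : ∀ m n : ℤ, i (m, n) = m • X + n • Y := fun m n => by simp [i]
  have hi : Function.Injective i := by
    rw [injective_iff_map_eq_zero]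
    rintro ⟨m, n⟩ h0
    rw [hi_apply] at h0
    obtain ⟨rfl, rfl⟩ := hindep m n h0
    rfl
  -- `ψ` reads off the coefficient of `Y`; perturbing by both `ψ` and `-ψ` covers both signs of that
  -- coefficient.
  obtain ⟨ψ, hψ⟩ := exists_extend_real i hi ((Int.castAddHom ℝ).comp (AddMonoidHom.snd ℤ ℤ))
  have hψ' : ∀ m n : ℤ, ψ (m • X + n • Y) = n := fun m n => by
    rw [← hi_apply, hψ]; rfl
  have e1 := h.eventually_pos φ ψ fun g hg => Or.inl (hφ g hg)
  have e2 := h.eventually_pos φ (-ψ) fun g hg => Or.inl (hφ g hg)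
  obtain ⟨ε, ⟨h1, h2⟩, hε⟩ := ((e1.and e2).and self_mem_nhdsWithin).exists
  have hε : 0 < ε := hε
  have hX0 : φ X ≠ 0 := fun h0 => by
    have h1 : x = 1 := hφ0 x h0
    exact one_ne_zero (hindep 1 0 (by simp [hX, h1])).1
  let S : AddSubgroup ℝ := (φ.comp i).range
  -- The image of a rank two group is not cyclic, hence dense. The bound `|φ X|` rules out `n = 0`,
  -- and the bound `ε` lets the perturbation outweigh `φ`, which makes the negative element `-g`
  -- positive.
  obtain ⟨m, n, h3, h4⟩ : ∃ m n : ℤ, 0 < φ (m • X + n • Y) ∧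
      φ (m • X + n • Y) < min ε |φ X| := by
    rcases S.dense_or_cyclic with hd | ⟨c, hc⟩
    · obtain ⟨r, ⟨⟨m, n⟩, hr⟩, hr1, hr2⟩ :=
        hd.exists_between (show (0 : ℝ) < min ε |φ X| from lt_min hε (abs_pos.2 hX0))
      refine ⟨m, n, ?_⟩
      rw [← hi_apply]
      change φ (i (m, n)) = r at hr
      rw [hr]
      exact ⟨hr1, hr2⟩
    · exfalso
      have hXS : φ X ∈ S := ⟨(1, 0), by simp [hi_apply]⟩
      have hYS : φ Y ∈ S := ⟨(0, 1), by simp [hi_apply]⟩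
      rw [hc, AddSubgroup.mem_closure_singleton] at hXS hYS
      obtain ⟨k, hk⟩ := hXS
      obtain ⟨l, hl⟩ := hYS
      have : φ (l • X + (-k) • Y) = 0 := by
        rw [map_add, map_zsmul, map_zsmul, ← hk, ← hl]
        simp only [zsmul_eq_mul]
        push_cast
        ring
      have h0 := hindep l (-k) (Additive.toMul.injective (hφ0 _ this))
      have hk0 : k = 0 := by omega
      rw [hk0, zero_smul] at hk
      exact hX0 hk.symm
  have hn : n ≠ 0 := by
    rintro rfl
    have h5 := h4.trans_le (min_le_right _ _)
    rw [zero_smul, add_zero, map_zsmul, zsmul_eq_mul] at h3 h5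
    have h6 : |(m : ℝ) * φ X| < |φ X| := by rwa [abs_of_pos h3]
    rw [abs_mul] at h6
    have hm : m ≠ 0 := by rintro rfl; simp at h3
    have h7 : (1 : ℝ) ≤ |(m : ℝ)| := by exact_mod_cast Int.one_le_abs hm
    nlinarith [abs_nonneg (φ X)]
  set g := m • X + n • Y with hg
  have hgneg : ¬ o.Pos (Additive.toMul (-g)) := fun hp => by
    have := hφ _ hp
    rw [ofMul_toMul, map_neg] at this
    linarith
  have h5 := h4.trans_le (min_le_left _ _)
  rcases lt_or_gt_of_ne hn with h6 | h6
  · refine hgneg (h1 _ ?_)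
    rw [ofMul_toMul, map_neg, map_neg, hψ']
    have : (n : ℝ) ≤ -1 := by exact_mod_cast (by omega : n ≤ -1)
    nlinarith
  · refine hgneg (h2 _ ?_)
    rw [ofMul_toMul, AddMonoidHom.neg_apply, map_neg, map_neg, hψ']
    have : (1 : ℝ) ≤ n := by exact_mod_cast (by omega : 1 ≤ n)
    nlinarith


/-! ### Bi-invariant orderings and rank one quotients -/

theorem IsBiinvariant.pow_lt_pow {o : LeftOrdering G} (hb : o.IsBiinvariant) {x y : G}
    (h : o.lt x y) {n : ℕ} (hn : 0 < n) : o.lt (x ^ n) (y ^ n) := by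
  let _ := o.toLinearOrder
  have : MulLeftMono G := o.mulLeftMono
  have : MulRightMono G := hb.mulRightMono
  exact pow_left_strictMono (M := G) (by omega) (show x < y from h)

theorem IsBiinvariant.lt_of_pow {o : LeftOrdering G} (hb : o.IsBiinvariant) {x y : G} {n : ℕ}
    (h : o.lt (x ^ n) (y ^ n)) : o.lt x y := by
  have hn : 0 < n := Nat.pos_of_ne_zero fun e => h.2 (by rw [e, pow_zero, pow_zero])
  rcases o.lt_trichotomy x y with h1 | rfl | h1
  · exact h1
  · exact absurd rfl h.2
  · exact absurd (o.lt_trans h (hb.pow_lt_pow h1 hn)).2 (fun h => h rfl)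

theorem IsBiinvariant.eq_of_pow {o : LeftOrdering G} (hb : o.IsBiinvariant) {x y : G} {n : ℕ}
    (hn : 0 < n) (h : x ^ n = y ^ n) : x = y := by
  rcases o.lt_trichotomy x y with h1 | h1 | h1
  · exact absurd h (hb.pow_lt_pow h1 hn).2
  · exact h1
  · exact absurd h.symm (hb.pow_lt_pow h1 hn).2

/-- The ordering by the action on the conjugacy class of `x`, with ties broken by `o`. -/
theorem IsBiinvariant.exists_conj {o : LeftOrdering G} (hb : o.IsBiinvariant) (x : G) :
    ∃ o' : LeftOrdering G, ∀ g, o'.Pos g ↔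
      o.Pos (g * x * g⁻¹ * x⁻¹) ∨ (g * x * g⁻¹ * x⁻¹ = 1 ∧ o.Pos g) := by
  refine ⟨ofCone _ ?_ ?_ ?_, fun g => pos_ofCone⟩
  · simp [o.not_pos_one]
  · intro a b ha hb'
    -- The cocycle identity for commutators with `x`; bi-invariance keeps the conjugated factor
    -- positive.
    have e : a * b * x * (a * b)⁻¹ * x⁻¹ =
        (a * (b * x * b⁻¹ * x⁻¹) * a⁻¹) * (a * x * a⁻¹ * x⁻¹) := by group
    rw [e]
    rcases ha with h | ⟨h, h'⟩ <;> rcases hb' with k | ⟨k, k'⟩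
    · exact Or.inl ((hb a _ k).mul h)
    · exact Or.inl (by rw [k]; simpa using h)
    · exact Or.inl (by rw [h]; simpa using hb a _ k)
    · exact Or.inr ⟨by rw [h, k]; group, h'.mul k'⟩
  · intro a ha
    have e : a⁻¹ * x * a⁻¹⁻¹ * x⁻¹ = a⁻¹ * (a * x * a⁻¹ * x⁻¹)⁻¹ * a⁻¹⁻¹ := by group
    by_cases h : a * x * a⁻¹ * x⁻¹ = 1
    · rcases o.pos_or ha with h' | h'
      · exact Or.inl (Or.inr ⟨h, h'⟩)
      · exact Or.inr (Or.inr ⟨by rw [e, h]; group, h'⟩)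
    · rcases o.pos_or h with h' | h'
      · exact Or.inl (Or.inl h')
      · exact Or.inr (Or.inl (by rw [e]; exact hb _ _ h'))

/-- Modulo `N`, any two elements have a common multiple in the sense of rank one groups. -/
def RankOneMod (N : Subgroup G) : Prop :=
  ∀ x y, y ∉ N → ∃ (p : ℕ) (q : ℤ), 0 < p ∧ x ^ p * y ^ q ∈ N

theorem zpow_pos_iff {o : LeftOrdering G} {g : G} (hg : o.Pos g) {n : ℤ} :
    o.Pos (g ^ n) ↔ 0 < n := by
  rcases _root_.lt_trichotomy 0 n with h | h | h
  · obtain ⟨k, rfl⟩ := Int.eq_ofNat_of_zero_le h.le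
    rw [zpow_natCast]
    exact ⟨fun _ => h, fun _ => hg.pow (by omega)⟩
  · subst h
    simp [o.not_pos_one]
  · refine ⟨fun h' => ?_, fun h' => by omega⟩
    obtain ⟨k, hk⟩ := Int.eq_ofNat_of_zero_le (show 0 ≤ -n by omega)
    have : o.Pos (g ^ (-n)) := by
      rw [hk, zpow_natCast]
      exact hg.pow (by omega)
    rw [zpow_neg] at this
    exact absurd this h'.not_inv

/-- In a rank one group modulo a convex normal subgroup, two positive elements have
positive powers in the same coset. -/
theorem IsConvex.exists_pow_mul_mem {o : LeftOrdering G} {N : Subgroup G} [N.Normal]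
    (hN : o.IsConvex (N : Set G)) {x y : G} (hx : o.Pos x) (hy : o.Pos y) (hxN : x ∉ N)
    {p : ℕ} {q : ℤ} (hp : 0 < p) (h : x ^ p * y ^ q ∈ N) :
    ∃ r : ℕ, 0 < r ∧ (y ^ r)⁻¹ * x ^ p ∈ N := by
  have h1 : x ^ p ∉ N := fun h' => hxN (hN.mem_of_pow_mem hp h')
  have h2 : y ^ q * x ^ p ∈ N := Subgroup.Normal.mem_comm inferInstance h
  have h3 : o.Pos (y ^ (-q)) := by
    have := hN.pos_mul h1 (N.inv_mem h2) (hx.pow hp)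
    rw [zpow_neg]
    simpa using this
  have h4 := (zpow_pos_iff hy).1 h3
  obtain ⟨r, hr⟩ := Int.eq_ofNat_of_zero_le h4.le
  refine ⟨r, by omega, ?_⟩
  have : y ^ r = y ^ (-q) := by rw [hr]; simp
  rw [this]
  simpa using h2

theorem IsConvex.isArch_quotient {o : LeftOrdering G} {N : Subgroup G} [N.Normal]
    {o' : LeftOrdering (G ⧸ N)} (ho' : ∀ g : G, o'.Pos (g : G ⧸ N) ↔ g ∉ N ∧ o.Pos g)
    (ha : ∀ x y, o.Pos y → y ∉ N → ∃ n : ℕ, o.lt x (y ^ n)) : o'.IsArch := by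
  intro x y hy
  induction x using QuotientGroup.induction_on with
  | H x =>
    induction y using QuotientGroup.induction_on with
    | H y =>
      obtain ⟨hyN, hy⟩ := (ho' y).1 hy
      obtain ⟨n, hn⟩ := ha x y hy hyN
      have h1 : o.Pos (x⁻¹ * y ^ n) := o.lt_iff_pos.1 hn
      by_cases hmem : x⁻¹ * y ^ n ∈ N
      -- Here `x` and `y ^ n` agree in the quotient, so one more factor `y` is needed.
      · refine ⟨n + 1, (lt_iff_pos _).2 ?_⟩
        have : ((x : G ⧸ N))⁻¹ * (y : G ⧸ N) ^ (n + 1) = ((x⁻¹ * y ^ n : G) : G ⧸ N) * y := by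
          rw [pow_succ]; simp [mul_assoc]
        rw [this, (QuotientGroup.eq_one_iff _).2 hmem, one_mul]
        exact (ho' y).2 ⟨hyN, hy⟩
      · exact ⟨n, (lt_iff_pos _).2 ((ho' (x⁻¹ * y ^ n)).2 ⟨hmem, h1⟩)⟩

/-- The quotient of an isolated Conradian ordering by the maximal convex subgroup is commutative
of rank one. -/
theorem IsolatedBy.rankOneMod {o : LeftOrdering G} {F : Finset G} (h : o.IsolatedBy F)
    (hC : o.IsConradian) {N : Subgroup G} (hN : o.IsMaxConvex N) :
    (∀ x y, x * y * x⁻¹ * y⁻¹ ∈ N) ∧ RankOneMod N := by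
  have := hN.normal hC
  obtain ⟨o', ho'⟩ := o.exists_quotient hN.convex
  have ha : o'.IsArch := IsConvex.isArch_quotient ho'
    fun x y hy hyN => hN.exists_lt_pow hC hy hyN x
  obtain ⟨F', hF'⟩ := h.quotient ho'
  have hcomm := (hF'.isBiinvariant_of_isArch ha).mul_comm_of_isArch ha
  refine ⟨fun x y => ?_, fun x y hy => ?_⟩
  · rw [← QuotientGroup.eq_one_iff]
    simp only [QuotientGroup.mk_mul, QuotientGroup.mk_inv]
    rw [hcomm (x : G ⧸ N) y]
    group
  · obtain ⟨p, q, hp, hpq⟩ := @IsolatedBy.rank_one_of_isArch (G ⧸ N)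
      { (inferInstance : Group (G ⧸ N)) with mul_comm := hcomm } o' F' hF' ha x y
      (fun e => hy ((QuotientGroup.eq_one_iff y).1 e))
    exact ⟨p, q, hp, (QuotientGroup.eq_one_iff _).1 hpq⟩

/-- A commutative group of rank two with a convex subgroup of rank one has no isolated ordering. -/
theorem IsolatedBy.false_of_comm {A : Type*} [CommGroup A] {o : LeftOrdering A} {F : Finset A}
    (h : o.IsolatedBy F) {M : Subgroup A} (hM : o.IsConvex (M : Set A)) (hbot : M ≠ ⊥)
    (htop : M ≠ ⊤) (harch : (o.restrict M).IsArch)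
    (harch' : ∀ x y, o.Pos y → y ∉ M → ∃ n : ℕ, o.lt x (y ^ n)) : False := by
  obtain ⟨o', ho'⟩ := o.exists_quotient hM
  have ha : o'.IsArch := IsConvex.isArch_quotient ho' harch'
  obtain ⟨φ, hφ⟩ := harch.exists_real_hom
  obtain ⟨π, hπ⟩ := ha.exists_real_hom
  obtain ⟨ψ, hψ⟩ := exists_extend_real M.subtype.toAdditive Subtype.val_injective φ
  have hψ' : ∀ m (hm : m ∈ M), ψ (Additive.ofMul m) = φ (Additive.ofMul ⟨m, hm⟩) :=
    fun m hm => hψ (Additive.ofMul ⟨m, hm⟩)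
  let π' : Additive A →+ ℝ := π.comp (QuotientGroup.mk' M).toAdditive
  have hπ1 : ∀ g, g ∈ M → π' (Additive.ofMul g) = 0 := by
    intro g hg
    have : π' (Additive.ofMul g) = π (Additive.ofMul (g : A ⧸ M)) := rfl
    rw [this, (QuotientGroup.eq_one_iff g).2 hg, ofMul_one, map_zero]
  have hev := h.eventually_pos π' ψ fun g hg => by
    by_cases hgM : g ∈ M
    · refine Or.inr ⟨hπ1 g hgM, ?_⟩
      rw [hψ' g hgM]
      exact hφ _ (o.pos_restrict.2 hg)
    · exact Or.inl (hπ _ ((ho' g).2 ⟨hgM, hg⟩))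
  obtain ⟨ε, hε, hε0⟩ := (hev.and self_mem_nhdsWithin).exists
  have hε0 : 0 < ε := hε0
  obtain ⟨y, -, hyM, hy⟩ := o.exists_pos_of_not_le (fun h => htop (top_le_iff.1 h))
  obtain ⟨x, hxM, -, hx⟩ := o.exists_pos_of_not_le (fun h => hbot (le_bot_iff.1 h))
  have hψx : 0 < ψ (Additive.ofMul x) := by
    rw [hψ' x hxM]
    exact hφ _ (o.pos_restrict.2 hx)
  -- On `M` the perturbed homomorphism is `ε * ψ`, so some power of `x ∈ M` overtakes `y`, although
  -- `y` lies above `M`.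
  obtain ⟨k, hk⟩ := exists_nat_gt
    ((π' (Additive.ofMul y) + ε * ψ (Additive.ofMul y)) / (ε * ψ (Additive.ofMul x)))
  rw [div_lt_iff₀ (mul_pos hε0 hψx)] at hk
  have h1 : o.Pos (y⁻¹ * x ^ k) := by
    refine hε _ ?_
    rw [ofMul_mul, ofMul_inv, ofMul_pow, map_add, map_add, map_neg, map_neg, map_nsmul, map_nsmul,
      hπ1 x hxM]
    simp only [nsmul_eq_mul]
    linarith
  have h2 := hM.mul_pos hyM (M.inv_mem (M.pow_mem hxM k)) hy
  exact h1.not_inv (by simpa using h2)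


/-! ### Conjugation on a convex subgroup of rank one -/

/-- Conjugation by `g` increases the positive elements of `M`. -/
def Expands (o : LeftOrdering G) (M : Subgroup G) (g : G) : Prop :=
  ∀ y ∈ M, o.Pos y → o.lt y (g * y * g⁻¹)

/-- Any two positive elements of `M` have a common positive power. -/
def PosRankOne (o : LeftOrdering G) (M : Subgroup G) : Prop :=
  ∀ x ∈ M, ∀ y ∈ M, o.Pos x → o.Pos y → ∃ p q : ℕ, 0 < p ∧ 0 < q ∧ x ^ p = y ^ q

theorem IsBiinvariant.conj_lt {o : LeftOrdering G} (hb : o.IsBiinvariant) (g : G) {x y : G}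
    (h : o.lt x y) : o.lt (g * x * g⁻¹) (g * y * g⁻¹) := by
  rw [lt_iff_pos] at h ⊢
  have e : (g * x * g⁻¹)⁻¹ * (g * y * g⁻¹) = g * (x⁻¹ * y) * g⁻¹ := by group
  rw [e]
  exact hb g _ h

theorem Expands.pow {o : LeftOrdering G} {M : Subgroup G} [M.Normal] (hb : o.IsBiinvariant) {g : G}
    (h : o.Expands M g) {n : ℕ} (hn : 0 < n) : o.Expands M (g ^ n) := by
  induction n, hn using Nat.le_induction with
  | base => simpa using h
  | succ n _ ih =>
    intro y hy hp
    have h1 := h _ (Subgroup.Normal.conj_mem inferInstance y hy (g ^ n)) (hb _ _ hp)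
    have e : g ^ (n + 1) * y * (g ^ (n + 1))⁻¹ = g * (g ^ n * y * (g ^ n)⁻¹) * g⁻¹ := by
      rw [pow_succ']; group
    rw [e]
    exact o.lt_trans (ih y hy hp) h1

theorem Expands.inv_lt {o : LeftOrdering G} {M : Subgroup G} (hb : o.IsBiinvariant) {g : G}
    (h : o.Expands M g⁻¹) {y : G} (hy : y ∈ M) (hp : o.Pos y) : o.lt (g * y * g⁻¹) y := by
  have := hb.conj_lt g (h y hy hp)
  have e : g * (g⁻¹ * y * g⁻¹⁻¹) * g⁻¹ = y := by group
  rwa [e] at this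

/-- Conjugation acts on a rank one subgroup by increasing all positive elements, by decreasing
all of them, or trivially. -/
theorem PosRankOne.trichotomy {o : LeftOrdering G} {M : Subgroup G} (hb : o.IsBiinvariant)
    (hM : o.PosRankOne M) (g : G) :
    o.Expands M g ∨ o.Expands M g⁻¹ ∨ ∀ y ∈ M, g * y * g⁻¹ = y := by
  by_cases hex : ∃ y₀ ∈ M, o.Pos y₀
  · obtain ⟨y₀, hy₀, hp₀⟩ := hex
    have hexp : ∀ g : G, o.lt y₀ (g * y₀ * g⁻¹) → o.Expands M g := by
      intro g hg y hy hp
      obtain ⟨p, q, hp', hq, e⟩ := hM y hy y₀ hy₀ hp hp₀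
      refine hb.lt_of_pow (n := p) ?_
      rw [conj_pow, e, ← conj_pow]
      exact hb.pow_lt_pow hg hq
    rcases o.lt_trichotomy y₀ (g * y₀ * g⁻¹) with h | h | h
    · exact Or.inl (hexp g h)
    · refine Or.inr (Or.inr ?_)
      have key : ∀ y ∈ M, o.Pos y → g * y * g⁻¹ = y := by
        intro y hy hp
        obtain ⟨p, q, hp', hq, e⟩ := hM y hy y₀ hy₀ hp hp₀
        refine hb.eq_of_pow hp' ?_
        rw [conj_pow, e, ← conj_pow, ← h]
      intro y hy
      by_cases h1 : y = 1
      · rw [h1]; group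
      · rcases o.pos_or h1 with h2 | h2
        · exact key y hy h2
        · have := congrArg (·⁻¹) (key _ (M.inv_mem hy) h2)
          simpa [mul_assoc] using this
    · refine Or.inr (Or.inl (hexp g⁻¹ ?_))
      have := hb.conj_lt g⁻¹ h
      have e : g⁻¹ * (g * y₀ * g⁻¹) * g⁻¹⁻¹ = y₀ := by group
      rwa [e] at this
  · push Not at hex
    exact Or.inl fun y hy hp => absurd hp (hex y hy)

/-- Since `M` is commutative, conjugation on `M` depends only on the coset modulo `M`. Hence `f ^ p`
acts as `a ^ r`, and the trichotomy leaves only one possibility for `f`. -/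
theorem Expands.of_pow {o : LeftOrdering G} {M : Subgroup G} [M.Normal] (hb : o.IsBiinvariant)
    (hM : o.PosRankOne M) (hMc : ∀ x ∈ M, ∀ y ∈ M, x * y = y * x) (hbot : M ≠ ⊥) {a f : G}
    (ha : o.Expands M a) {p r : ℕ} (hp : 0 < p) (hr : 0 < r) (h : (a ^ r)⁻¹ * f ^ p ∈ M) :
    o.Expands M f := by
  obtain ⟨y, hy, -, hpos⟩ := o.exists_pos_of_not_le (fun h => hbot (le_bot_iff.1 h))
  have h1 : o.lt y (f ^ p * y * (f ^ p)⁻¹) := by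
    have e : f ^ p * y * (f ^ p)⁻¹ =
        a ^ r * (((a ^ r)⁻¹ * f ^ p) * y * ((a ^ r)⁻¹ * f ^ p)⁻¹) * (a ^ r)⁻¹ := by group
    rw [e, hMc _ h y hy, mul_assoc y, mul_inv_cancel, mul_one]
    exact ha.pow hb hr y hy hpos
  rcases hM.trichotomy hb f with h2 | h2 | h2
  · exact h2
  · have h3 := (h2.pow hb hp)
    rw [inv_pow] at h3
    exact absurd (o.lt_trans h1 (h3.inv_lt hb hy hpos)).2 (fun h => h rfl)
  · exfalso
    have key : ∀ n : ℕ, f ^ n * y * (f ^ n)⁻¹ = y := by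
      intro n
      induction n with
      | zero => simp
      | succ n ih =>
        have e : f ^ (n + 1) * y * (f ^ (n + 1))⁻¹ = f * (f ^ n * y * (f ^ n)⁻¹) * f⁻¹ := by
          rw [pow_succ']; group
        rw [e, ih, h2 y hy]
    rw [key] at h1
    exact h1.2 rfl

/-- A bi-invariant ordering is not isolated if some `b` contracts the convex rank one subgroup `M`
while the action on `M` of all positive elements outside of `M` moves some `m` upwards. -/
theorem IsolatedBy.false_of_contracts {o : LeftOrdering G} {F : Finset G} (h : o.IsolatedBy F)
    {M : Subgroup G} [M.Normal] (hM : o.IsConvex (M : Set G)) (hb : o.IsBiinvariant)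
    (hMa : (o.restrict M).IsArch) (hMc : ∀ x ∈ M, ∀ y ∈ M, x * y = y * x) (hbot : M ≠ ⊥)
    (htop : M ≠ ⊤) (hGc : ∀ x y, x * y * x⁻¹ * y⁻¹ ∈ M) {b m : G} (hbM : o.Expands M b⁻¹)
    (hm : m ∈ M) (hfm : ∀ f, o.Pos f → f ∉ M → o.Pos (f * m * f⁻¹ * m⁻¹)) : False := by
  have harch : ∀ x ∈ M, ∀ y ∈ M, o.Pos y → ∃ n : ℕ, ∀ k ≥ n, o.lt x (y ^ k) := by
    intro x hx y hy hp
    obtain ⟨n, hn⟩ := hMa ⟨x, hx⟩ ⟨y, hy⟩ (o.pos_restrict.2 hp)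
    have hn' : o.lt x (y ^ n) := by
      rw [lt_iff_pos] at hn ⊢
      exact o.pos_restrict.1 hn
    refine ⟨n, fun k hk => ?_⟩
    obtain ⟨j, rfl⟩ := Nat.exists_eq_add_of_le hk
    rcases Nat.eq_zero_or_pos j with rfl | hj
    · exact hn'
    · refine o.lt_trans hn' ((lt_iff_pos _).2 ?_)
      rw [pow_add, inv_mul_cancel_left]
      exact hp.pow hj
  have hconj : ∀ (g : G) {x : G}, x ∈ M → g * x * g⁻¹ ∈ M := fun g x hx =>
    Subgroup.Normal.conj_mem inferInstance x hx g
  -- Write `[f, x]` for `f * x * f⁻¹ * x⁻¹`. For `f ∈ M` the factor `m ^ k` has no effect and `b`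
  -- contracts; for `f ∉ M` one has `[f, m ^ k * b] = [f, b] * [f, m] ^ k`, positive for large `k`.
  have hF : ∀ᶠ k : ℕ in Filter.atTop, ∀ f ∈ F,
      o.Pos (f * (m ^ k * b) * f⁻¹ * (m ^ k * b)⁻¹) := by
    rw [Filter.eventually_all_finset]
    intro f hf
    have hfp := h.pos f hf
    by_cases hfM : f ∈ M
    · refine Filter.Eventually.of_forall fun k => ?_
      have h1 := hbM.inv_lt hb hfM hfp
      have h2 : f * (m ^ k * b) * f⁻¹ * (m ^ k * b)⁻¹ = (b * f * b⁻¹)⁻¹ * f := by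
        have e : f * (m ^ k * b) * f⁻¹ * (m ^ k * b)⁻¹ =
            (f * m ^ k) * (b * f * b⁻¹)⁻¹ * (m ^ k)⁻¹ := by group
        rw [e, hMc f hfM _ (M.pow_mem hm k), mul_assoc (m ^ k),
          hMc f hfM _ (M.inv_mem (hconj b hfM)),
          hMc _ (M.pow_mem hm k) _ (M.mul_mem (M.inv_mem (hconj b hfM)) hfM)]
        group
      rw [h2]
      exact o.lt_iff_pos.1 h1
    · have hc := hfm f hfp hfM
      obtain ⟨n, hn⟩ := harch _ (M.inv_mem (hGc f b)) _
        (M.mul_mem (hconj f hm) (M.inv_mem hm)) hc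
      filter_upwards [Filter.eventually_ge_atTop n] with k hk
      have h1 := o.lt_iff_pos.1 (hn k hk)
      rw [inv_inv] at h1
      have hcm : Commute (f * m * f⁻¹) m⁻¹ := hMc _ (hconj f hm) _ (M.inv_mem hm)
      have e : f * (m ^ k * b) * f⁻¹ * (m ^ k * b)⁻¹ =
          f * b * f⁻¹ * b⁻¹ * (f * m * f⁻¹ * m⁻¹) ^ k := by
        rw [hcm.mul_pow, conj_pow, inv_pow,
          ← mul_assoc (f * b * f⁻¹ * b⁻¹), hMc _ (hGc f b) _ (hconj f (M.pow_mem hm k))]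
        group
      rw [e]
      exact h1
  obtain ⟨k, hk⟩ := hF.exists
  set x := m ^ k * b with hx
  obtain ⟨o', ho'⟩ := hb.exists_conj x
  have heq : o' = o := h.eq o' fun f hf => (ho' f).2 (Or.inl (hk f hf))
  -- The conjugation ordering is now `o`. But `x` contracts `M`, so for large `n` the commutator of
  -- `a * (y ^ n)⁻¹` with `x` is negative, while `o` makes the whole coset `aM` positive.
  obtain ⟨a, -, haM, ha⟩ := o.exists_pos_of_not_le (fun h => htop (top_le_iff.1 h))
  obtain ⟨y, hy, -, hyp⟩ := o.exists_pos_of_not_le (fun h => hbot (le_bot_iff.1 h))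
  have hxy : o.lt (x * y * x⁻¹) y := by
    have e : x * y * x⁻¹ = m ^ k * (b * y * b⁻¹) * (m ^ k)⁻¹ := by rw [hx]; group
    rw [e, hMc _ (M.pow_mem hm k) _ (hconj b hy), mul_assoc, mul_inv_cancel, mul_one]
    exact hbM.inv_lt hb hy hyp
  obtain ⟨n, hn⟩ := harch _ (hGc x a⁻¹) _ (M.mul_mem (M.inv_mem (hconj x hy)) hy)
    (o.lt_iff_pos.1 hxy)
  have h1 := o.lt_iff_pos.1 (hn n le_rfl)
  have hg : o'.Pos (a * (y ^ n)⁻¹) := by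
    rw [heq]
    exact hM.pos_mul haM (M.inv_mem (M.pow_mem hy n)) ha
  have hcm : Commute (x * y * x⁻¹)⁻¹ y := hMc _ (M.inv_mem (hconj x hy)) _ hy
  have e : (a * (y ^ n)⁻¹ * x * (a * (y ^ n)⁻¹)⁻¹ * x⁻¹)⁻¹ =
      a * ((x * a⁻¹ * x⁻¹ * a⁻¹⁻¹)⁻¹ * ((x * y * x⁻¹)⁻¹ * y) ^ n) * a⁻¹ := by
    rw [hcm.mul_pow, inv_pow, conj_pow]
    group
  have h2 := hb a _ h1
  rw [← e] at h2
  rcases (ho' _).1 hg with h3 | ⟨h3, -⟩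
  · exact h3.not_inv h2
  · rw [h3, inv_one] at h2
    exact o.not_pos_one h2

theorem PosRankOne.isArch_restrict {o : LeftOrdering G} {M : Subgroup G} (hM : o.PosRankOne M) :
    (o.restrict M).IsArch := by
  intro x y hy
  by_cases hx : (o.restrict M).Pos x
  · obtain ⟨p, q, hp, hq, e⟩ := hM x x.2 y y.2 (o.pos_restrict.1 hx) (o.pos_restrict.1 hy)
    have e' : x ^ p = y ^ q := Subtype.ext (by simpa using e)
    refine ⟨q + 1, (lt_iff_pos _).2 ?_⟩
    obtain ⟨j, rfl⟩ : ∃ j, p = j + 1 := ⟨p - 1, by omega⟩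
    rw [pow_succ, ← e', pow_succ', ← mul_assoc, inv_mul_cancel_left]
    rcases Nat.eq_zero_or_pos j with rfl | hj
    · simpa using hy
    · exact (hx.pow hj).mul hy
  · refine ⟨1, (lt_iff_pos _).2 ?_⟩
    rw [pow_one]
    by_cases h1 : x = 1
    · simpa [h1] using hy
    · exact (((o.restrict M).pos_inv_of_not h1 hx)).mul hy

/-- An isolated ordering with a convex normal subgroup `M`, such that both `M` and the quotient
by `M` are commutative of rank one, is not invariant under conjugation on `M`. -/
theorem IsolatedBy.exists_conj_not_pos {o : LeftOrdering G} {F : Finset G} (h : o.IsolatedBy F)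
    {M : Subgroup G} [M.Normal] (hM : o.IsConvex (M : Set G)) (hMr : o.PosRankOne M)
    (hMc : ∀ x ∈ M, ∀ y ∈ M, x * y = y * x) (hbot : M ≠ ⊥)
    (htop : M ≠ ⊤) (hGc : ∀ x y, x * y * x⁻¹ * y⁻¹ ∈ M) (hGr : RankOneMod M) :
    ∃ g, ∃ x ∈ M, o.Pos x ∧ ¬ o.Pos (g * x * g⁻¹) := by
  by_contra! hinv
  have hb : o.IsBiinvariant := by
    intro x g hg
    by_cases hgM : g ∈ M
    · exact hinv x g hgM hg
    -- Conjugation changes `g` by a factor in `M`, which does not affect its sign.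
    · have := hM.mul_pos hgM (hGc x g) hg
      simpa using this
  have hMa := hMr.isArch_restrict
  by_cases hcen : ∀ g, ∀ y ∈ M, g * y * g⁻¹ = y
  · have hcen' : ∀ g, ∀ y ∈ M, Commute g y := fun g y hy => by
      rw [commute_iff_eq]
      conv_rhs => rw [← hcen g y hy]
      group
    have hcomm : ∀ a b : G, a * b = b * a := by
      intro a b
      by_cases hbM : b ∈ M
      · exact hcen' a b hbM
      -- `b` commutes with `a ^ p * b ^ q`, hence with `a ^ p`, hence with `a` by uniqueness of
      -- roots.
      · obtain ⟨p, q, hp, hpq⟩ := hGr a b hbM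
        have h1 : b * a ^ p * b⁻¹ = a ^ p := by
          have h2 := hcen b _ hpq
          have e : b * (a ^ p * b ^ q) * b⁻¹ = (b * a ^ p * b⁻¹) * b ^ q := by group
          rw [e] at h2
          exact mul_right_cancel h2
        rw [← conj_pow] at h1
        have h3 := hb.eq_of_pow hp h1
        rw [mul_inv_eq_iff_eq_mul] at h3
        exact h3.symm
    refine @IsolatedBy.false_of_comm G { (inferInstance : Group G) with mul_comm := hcomm } o F h M
      hM hbot htop hMa fun x y hy hyM => ?_
    by_cases hx : o.Pos x ∧ x ∉ M
    · obtain ⟨p, q, hp, hpq⟩ := hGr x y hyM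
      obtain ⟨r, hr, hmem⟩ := hM.exists_pow_mul_mem hx.1 hy hx.2 hp hpq
      obtain ⟨j, rfl⟩ : ∃ j, p = j + 1 := ⟨p - 1, by omega⟩
      refine ⟨r + 1, (lt_iff_pos _).2 ?_⟩
      have e : x⁻¹ * y ^ (r + 1) = x ^ j * (((y ^ r)⁻¹ * x ^ (j + 1))⁻¹ * y) := by
        rw [mul_inv_rev, inv_inv, pow_succ', pow_succ, mul_inv_rev, ← mul_assoc, ← mul_assoc,
          ← mul_assoc, hcomm (x ^ j)]
        group
      rw [e]
      have h5 := hM.mul_pos hyM (M.inv_mem hmem) hy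
      rcases Nat.eq_zero_or_pos j with rfl | hj
      · simpa using h5
      · exact (hx.1.pow hj).mul h5
    · refine ⟨1, (lt_iff_pos _).2 ?_⟩
      rw [pow_one]
      by_cases hxM : x ∈ M
      · exact hM.mul_pos hyM (M.inv_mem hxM) hy
      · exact (o.pos_inv_of_not (fun e : x = 1 => hxM (e ▸ M.one_mem)) fun h => hx ⟨h, hxM⟩).mul hy
  · push Not at hcen
    obtain ⟨a, y₁, hy₁, hne⟩ := hcen
    obtain ⟨y, hy, -, hyp⟩ := o.exists_pos_of_not_le (fun h => hbot (le_bot_iff.1 h))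
    have hex : ∃ a, o.Pos a ∧ (o.Expands M a ∨ o.Expands M a⁻¹) := by
      have ha : o.Expands M a ∨ o.Expands M a⁻¹ := by
        rcases hMr.trichotomy hb a with h1 | h1 | h1
        · exact Or.inl h1
        · exact Or.inr h1
        · exact absurd (h1 y₁ hy₁) hne
      have ha1 : a ≠ 1 := by
        rintro rfl
        exact hne (by group)
      rcases o.pos_or ha1 with h1 | h1
      · exact ⟨a, h1, ha⟩
      · exact ⟨a⁻¹, h1, by rw [inv_inv]; exact ha.symm⟩
    clear hne
    obtain ⟨a, hap, ha⟩ := hex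
    have haM : a ∉ M := by
      intro haM
      have hfix : ∀ c ∈ M, ¬ o.Expands M c := by
        intro c hc hE
        have := hE y hy hyp
        rw [hMc c hc y hy, mul_assoc, mul_inv_cancel, mul_one] at this
        exact this.2 rfl
      rcases ha with ha | ha
      · exact hfix a haM ha
      · exact hfix _ (M.inv_mem haM) ha
    -- All positive elements outside `M` act in the same direction as `a`. The contracting one of
    -- `a⁻¹` and `a` serves as `b`; `m` is `y` or `y⁻¹`, whichever they move upwards.
    rcases ha with ha | ha
    · refine h.false_of_contracts hM hb hMa hMc hbot htop hGc (b := a⁻¹) (m := y)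
        (by rwa [inv_inv]) hy fun f hf hfM => ?_
      obtain ⟨p, q, hp, hpq⟩ := hGr f a haM
      obtain ⟨r, hr, hmem⟩ := hM.exists_pow_mul_mem hf hap hfM hp hpq
      have h1 := o.lt_iff_pos.1 (ha.of_pow hb hMr hMc hbot hp hr hmem y hy hyp)
      have e : f * y * f⁻¹ * y⁻¹ = y * (y⁻¹ * (f * y * f⁻¹)) * y⁻¹ := by group
      rw [e]
      exact hb y _ h1
    · refine h.false_of_contracts hM hb hMa hMc hbot htop hGc (b := a) (m := y⁻¹)
        ha (M.inv_mem hy) fun f hf hfM => ?_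
      obtain ⟨p, q, hp, hpq⟩ := hGr f a haM
      obtain ⟨r, hr, hmem⟩ := hM.exists_pow_mul_mem hf hap hfM hp hpq
      have hmem' : ((a⁻¹) ^ r)⁻¹ * (f⁻¹) ^ p ∈ M := by
        have := M.inv_mem (Subgroup.Normal.mem_comm inferInstance hmem)
        simpa using this
      have h1 := o.lt_iff_pos.1 ((ha.of_pow hb hMr hMc hbot hp hr hmem').inv_lt hb hy hyp)
      have e : f * y⁻¹ * f⁻¹ * y⁻¹⁻¹ = (f * y * f⁻¹)⁻¹ * y := by group
      rw [e]
      exact h1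


/-! ### Reversed quotients and convexity for all orderings -/

theorem IsConradian.restrict {o : LeftOrdering G} (h : o.IsConradian) (N : Subgroup G) :
    (o.restrict N).IsConradian := by
  intro f g hf hg
  obtain ⟨n, hn⟩ := h f g (o.pos_restrict.1 hf) (o.pos_restrict.1 hg)
  exact ⟨n, (lt_iff_pos _).2 (o.pos_restrict.2 (o.lt_iff_pos.1 hn))⟩

/-- If all orderings have the same convex subgroups, then the maximal convex subgroup is
characteristic. -/
theorem IsMaxConvex.mem_of_mulEquiv {o : LeftOrdering G} {N : Subgroup G} (hN : o.IsMaxConvex N)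
    (hall : ∀ (o' : LeftOrdering G) (H : Subgroup G),
      o'.IsConvex (H : Set G) → o.IsConvex (H : Set G)) (α : G ≃* G) {x : G} (hx : α x ∈ N) :
    x ∈ N := by
  -- The preimage of `N` under `α` is convex for the pulled back ordering, hence for `o`; being
  -- proper, it cannot reach outside `N`.
  let o' : LeftOrdering G := ofCone (fun g => o.Pos (α g)) (by simp [o.not_pos_one])
    (fun a b ha hb => by rw [map_mul]; exact ha.mul hb)
    (fun a ha => by rw [map_inv]; exact o.pos_or (by simpa using ha))
  have ho' : o'.IsConvex (N.comap α.toMonoidHom : Set G) := by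
    rw [isConvex_subgroup_iff]
    intro x y hy hx hxy
    have hx' : o.Pos (α x) := (pos_ofCone (P := fun g => o.Pos (α g))).1 hx
    have hxy' := (pos_ofCone (P := fun g => o.Pos (α g))).1 hxy
    rw [map_mul, map_inv] at hxy'
    exact o.isConvex_subgroup_iff.1 hN.convex (α x) (α y) hy hx' hxy'
  by_contra hxN
  have htop := hN.eq_top_of_not_mem (hall o' _ ho') hxN hx
  refine hN.ne_top (top_le_iff.1 fun y _ => ?_)
  have : α.symm y ∈ N.comap α.toMonoidHom := htop ▸ Subgroup.mem_top _
  simpa using this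

/-- A rank one quotient of `N` that is reversed by conjugation with some element. -/
def IsReversedBy (K N : Subgroup G) (g : G) : Prop :=
  ∀ x ∈ N, x ∉ K → ∃ p q : ℕ, 2 ≤ p ∧ 2 ≤ q ∧ g * x ^ p * g⁻¹ * x ^ q ∈ K

theorem IsReversedBy.inv {K N : Subgroup G} [K.Normal] {g : G} (h : IsReversedBy K N g) :
    IsReversedBy K N g⁻¹ := by
  intro x hx hxK
  obtain ⟨p, q, hp, hq, hmem⟩ := h x hx hxK
  refine ⟨q, p, hq, hp, Subgroup.Normal.mem_comm inferInstance ?_⟩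
  have := Subgroup.Normal.conj_mem inferInstance _ hmem g⁻¹
  have e : g⁻¹ * (g * x ^ p * g⁻¹ * x ^ q) * g⁻¹⁻¹ = x ^ p * (g⁻¹ * x ^ q * g⁻¹⁻¹) := by group
  rwa [e] at this

/-- Every element has a positive power in `H`, and convex subgroups are closed under roots. -/
theorem RankOneMod.eq_top {o : LeftOrdering G} {N H : Subgroup G} (hr : RankOneMod N)
    (hH : o.IsConvex (H : Set G)) (hNH : N ≤ H) {z : G} (hzN : z ∉ N) (hzH : z ∈ H) : H = ⊤ := by
  refine top_le_iff.1 fun w _ => ?_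
  obtain ⟨p, q, hp, hpq⟩ := hr w z hzN
  exact hH.mem_of_pow_mem hp ((H.mul_mem_cancel_right (H.zpow_mem hzH q)).1 (hNH hpq))

/-- A normal subgroup with rank one quotient is convex for every ordering, if some element reverses
a rank one quotient of it. -/
theorem IsReversedBy.isConvex {K N : Subgroup G} [K.Normal] [N.Normal] {g : G}
    (h : IsReversedBy K N g) (hKN : K < N) (hr : RankOneMod N) (o : LeftOrdering G)
    (hK : (o.restrict N).IsConvex (K.subgroupOf N : Set N)) : o.IsConvex (N : Set G) := by
  let _ := o.toLinearOrder
  have : MulLeftMono G := o.mulLeftMono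
  have hmul : ∀ {a b : G}, (∃ x ∈ N, a ≤ x) → (∃ x ∈ N, b ≤ x) → ∃ x ∈ N, a * b ≤ x := by
    rintro a b ⟨x, hx, hax⟩ ⟨y, hy, hby⟩
    have hc : a * y * a⁻¹ ∈ N := Subgroup.Normal.conj_mem inferInstance y hy a
    refine ⟨a * y * a⁻¹ * x, N.mul_mem hc hx, (mul_le_mul_right hby a).trans ?_⟩
    have e : a * y = a * y * a⁻¹ * a := by group
    exact e.trans_le (mul_le_mul_right hax _)
  -- The convex hull of `N`; normality of `N` gives closure under products.
  let H : Subgroup G :=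
    { carrier := {a | (∃ x ∈ N, a ≤ x) ∧ ∃ x ∈ N, a⁻¹ ≤ x}
      mul_mem' := fun {a b} ha hb => ⟨hmul ha.1 hb.1, by rw [mul_inv_rev]; exact hmul hb.2 ha.2⟩
      one_mem' := ⟨⟨1, N.one_mem, le_rfl⟩, ⟨1, N.one_mem, by simp⟩⟩
      inv_mem' := fun {a} ha => ⟨ha.2, by simpa using ha.1⟩ }
  have hNH : N ≤ H := fun x hx => ⟨⟨x, hx, le_rfl⟩, ⟨x⁻¹, N.inv_mem hx, le_rfl⟩⟩
  have hH : o.IsConvex (H : Set G) := by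
    rw [isConvex_subgroup_iff]
    rintro a y ⟨⟨x, hx, hyx⟩, -⟩ ha hay
    have h1 : a < y := o.lt_iff_pos.2 hay
    have h2 : 1 < a := ha
    exact ⟨⟨x, hx, h1.le.trans hyx⟩, ⟨1, N.one_mem, by simpa using h2.le⟩⟩
  by_cases hHN : H ≤ N
  · rwa [_root_.le_antisymm hNH hHN]
  exfalso
  obtain ⟨z, hzH, hzN⟩ := SetLike.not_le_iff_exists.1 hHN
  have htop := hr.eq_top hH hNH hzN hzH
  obtain ⟨x₀, hx₀N, hx₀K, hx₀⟩ := o.exists_pos_of_not_le hKN.not_ge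
  have hKpos : ∀ x ∈ N, x ∉ K → o.Pos x → ∀ k ∈ K, o.Pos (k * x) := by
    intro x hx hxK hp k hk
    have := hK.mul_pos (g := ⟨x, hx⟩) (h := ⟨k, hKN.le hk⟩) hxK hk (o.pos_restrict.2 hp)
    exact o.pos_restrict.1 this
  have hg1 : g ≠ 1 := by
    rintro rfl
    obtain ⟨p, q, hp, hq, hmem⟩ := h x₀ hx₀N hx₀K
    have e : (⟨x₀, hx₀N⟩ : N) ^ (p + q) ∈ K.subgroupOf N := by
      rw [Subgroup.mem_subgroupOf]
      simpa [pow_add] using hmem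
    exact hx₀K (hK.mem_of_pow_mem (by omega) e)
  obtain ⟨a, ha, hrev⟩ : ∃ a, o.Pos a ∧ IsReversedBy K N a := by
    rcases o.pos_or hg1 with h1 | h1
    · exact ⟨g, h1, h⟩
    · exact ⟨g⁻¹, h1, h.inv⟩
  obtain ⟨x, hxN, hxK, hax⟩ : ∃ x ∈ N, x ∉ K ∧ a < x := by
    obtain ⟨⟨x, hx, hax⟩, -⟩ : a ∈ H := htop ▸ Subgroup.mem_top a
    have hlt : a < x * x₀ := hax.trans_lt (lt_mul_of_one_lt_right' x hx₀)
    by_cases hmem : x * x₀ ∈ K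
    · exact ⟨x₀, hx₀N, hx₀K, hlt.trans
        (o.lt_iff_pos.2 (hKpos x₀ hx₀N hx₀K hx₀ _ (K.inv_mem hmem)))⟩
    · exact ⟨_, N.mul_mem hx hx₀N, hmem, hlt⟩
  have hx1 : 1 < x := (show 1 < a from ha).trans hax
  obtain ⟨p, q, hp, hq, hmem⟩ := hrev x hxN hxK
  -- Since `2 ≤ q`, the exponent `j` is positive, so `x ^ j` stays outside `K`.
  obtain ⟨j, rfl⟩ : ∃ j, q = j + 1 := ⟨q - 1, by omega⟩
  have hxj : x ^ j ∉ K := fun h' => hxK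
    (hK.mem_of_pow_mem (g := ⟨x, hxN⟩) (n := j) (by omega)
      (by rw [Subgroup.mem_subgroupOf]; simpa using h'))
  set k := a * x ^ p * a⁻¹ * x ^ (j + 1) with hk
  -- This product is `a * x ^ p`. As `x⁻¹ * a` is negative, `k * (x ^ j)⁻¹` would be positive, but
  -- its inverse lies in the positive coset `x ^ j K`.
  have h1 : 1 < k * (x ^ j)⁻¹ * (x⁻¹ * a) := by
    have e : k * (x ^ j)⁻¹ * (x⁻¹ * a) = a * x ^ p := by
      rw [hk, pow_succ']; group
    rw [e]
    exact Pos.mul (o := o) ha (Pos.pow (o := o) hx1 (show 0 < p by omega))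
  have h2 : x⁻¹ * a < 1 := by simpa using mul_lt_mul_right hax x⁻¹
  have h3 : k * (x ^ j)⁻¹ * (x⁻¹ * a) < k * (x ^ j)⁻¹ := by
    simpa using mul_lt_mul_right h2 (k * (x ^ j)⁻¹)
  have h4 : 1 < k * (x ^ j)⁻¹ := h1.trans h3
  have h5 : o.Pos (x ^ j * k⁻¹) := by
    have hp5 := hK.pos_mul (g := ⟨x ^ j, N.pow_mem hxN j⟩) (h := ⟨k⁻¹, hKN.le (K.inv_mem hmem)⟩) hxj
      (K.inv_mem hmem) (o.pos_restrict.2 (Pos.pow (o := o) hx1 (show 0 < j by omega)))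
    exact o.pos_restrict.1 hp5
  exact Pos.not_inv h5 (by simpa using (show o.Pos (k * (x ^ j)⁻¹) from h4))

/-- In an isolated Conradian ordering, the second quotient from the top of the chain of convex
subgroups is reversed by some element. -/
theorem IsolatedBy.exists_isReversedBy {o : LeftOrdering G} {F : Finset G} (h : o.IsolatedBy F)
    (hC : o.IsConradian) {N : Subgroup G} (hN : o.IsMaxConvex N) {N' : Subgroup N}
    (hN' : (o.restrict N).IsMaxConvex N') [hK : (N'.map N.subtype).Normal] :
    ∃ g, IsReversedBy (N'.map N.subtype) N g := by
  classical
  have hNn := hN.normal hC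
  have hN'n := hN'.normal (hC.restrict N)
  obtain ⟨hcN, hrN⟩ := h.rankOneMod hC hN
  obtain ⟨hcN', hrN'⟩ := (h.restrict hN.convex).rankOneMod (hC.restrict N) hN'
  set K := N'.map N.subtype with hKdef
  have hKN : K ≤ N := Subgroup.map_subtype_le N'
  have memK : ∀ x : N, (x : G) ∈ K ↔ x ∈ N' := fun x =>
    ⟨fun ⟨y, hy, e⟩ => (Subtype.ext e : y = x) ▸ hy, fun hx => ⟨x, hx, rfl⟩⟩
  have hKconv : o.IsConvex (K : Set G) := hN.convex.map_subtype hN'.convex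
  obtain ⟨r, hr⟩ := o.exists_quotient hKconv
  obtain ⟨F', hF'⟩ := h.quotient hr
  let M : Subgroup (G ⧸ K) := N.map (QuotientGroup.mk' K)
  have memM : ∀ x : G, (x : G ⧸ K) ∈ M ↔ x ∈ N := by
    intro x
    constructor
    · rintro ⟨y, hy, e⟩
      have : y⁻¹ * x ∈ K := QuotientGroup.eq.1 e
      exact (N.mul_mem_cancel_left (N.inv_mem hy)).1 (hKN this)
    · exact fun hx => ⟨x, hx, rfl⟩
  have hMn : M.Normal := Subgroup.Normal.map hNn _ (QuotientGroup.mk'_surjective K)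
  have hMconv : r.IsConvex (M : Set (G ⧸ K)) := by
    rw [isConvex_subgroup_iff]
    intro x y hy hx hxy
    induction x using QuotientGroup.induction_on with
    | H x =>
      induction y using QuotientGroup.induction_on with
      | H y =>
        exact (memM x).2 (o.isConvex_subgroup_iff.1 hN.convex x y ((memM y).1 hy)
          ((hr x).1 hx).2 ((hr (x⁻¹ * y)).1 hxy).2)
  have hpow : ∀ x ∈ N, ∀ y ∈ N, x ∉ K → y ∉ K → o.Pos x → o.Pos y →
      ∃ p q : ℕ, 0 < p ∧ 0 < q ∧ (y ^ q)⁻¹ * x ^ p ∈ K := by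
    intro x hx y hy hxK hyK hxp hyp
    have hyK' : (⟨y, hy⟩ : N) ∉ N' := fun h' => hyK ((memK ⟨y, hy⟩).2 h')
    have hxK' : (⟨x, hx⟩ : N) ∉ N' := fun h' => hxK ((memK ⟨x, hx⟩).2 h')
    obtain ⟨p, q, hp, hpq⟩ := hrN' ⟨x, hx⟩ ⟨y, hy⟩ hyK'
    obtain ⟨s, hs, hmem⟩ := hN'.convex.exists_pow_mul_mem (o.pos_restrict.2 hxp)
      (o.pos_restrict.2 hyp) hxK' hp hpq
    exact ⟨p, s, hp, hs, (memK _).2 hmem⟩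
  have hMr : r.PosRankOne M := by
    intro x hx y hy hxp hyp
    induction x using QuotientGroup.induction_on with
    | H x =>
      induction y using QuotientGroup.induction_on with
      | H y =>
        obtain ⟨hxK, hxp⟩ := (hr x).1 hxp
        obtain ⟨hyK, hyp⟩ := (hr y).1 hyp
        obtain ⟨p, q, hp, hq, hmem⟩ := hpow x ((memM x).1 hx) y ((memM y).1 hy) hxK hyK hxp hyp
        exact ⟨p, q, hp, hq, (QuotientGroup.eq.2 hmem).symm⟩
  have hMc : ∀ x ∈ M, ∀ y ∈ M, x * y = y * x := by
    rintro _ ⟨x, hx, rfl⟩ _ ⟨y, hy, rfl⟩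
    refine QuotientGroup.eq.2 ?_
    have := (memK _).2 (hcN' ⟨y, hy⟩⁻¹ ⟨x, hx⟩⁻¹)
    have e : (x * y)⁻¹ * (y * x) = y⁻¹ * x⁻¹ * y⁻¹⁻¹ * x⁻¹⁻¹ := by group
    rw [e]
    exact this
  have hbot : M ≠ ⊥ := by
    intro e
    refine hN'.ne_top (top_le_iff.1 fun x _ => (memK x).1 ?_)
    have : ((x : G) : G ⧸ K) ∈ M := (memM x).2 x.2
    rw [e, Subgroup.mem_bot] at this
    exact (QuotientGroup.eq_one_iff _).1 this
  have htop : M ≠ ⊤ := fun e =>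
    hN.ne_top (top_le_iff.1 fun x _ => (memM x).1 (e ▸ Subgroup.mem_top _))
  have hGc : ∀ x y, x * y * x⁻¹ * y⁻¹ ∈ M := by
    intro x y
    induction x using QuotientGroup.induction_on with
    | H x =>
      induction y using QuotientGroup.induction_on with
      | H y => exact (memM _).2 (hcN x y)
  have hGr : RankOneMod M := by
    intro x y hy
    induction x using QuotientGroup.induction_on with
    | H x =>
      induction y using QuotientGroup.induction_on with
      | H y =>
        obtain ⟨p, q, hp, hpq⟩ := hrN x y fun h' => hy ((memM y).2 h')
        exact ⟨p, q, hp, (memM _).2 hpq⟩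
  obtain ⟨g, x, hx, hxp, hxn⟩ := hF'.exists_conj_not_pos hMconv hMr hMc hbot htop hGc hGr
  induction g using QuotientGroup.induction_on with
  | H g =>
    have hgx : r.Pos ((g : G ⧸ K) * x⁻¹ * (g : G ⧸ K)⁻¹) := by
      have := r.pos_inv_of_not (fun e => hxp.ne_one (by simpa using e)) hxn
      simpa [mul_assoc] using this
    obtain ⟨p, q, hp, hq, e⟩ := hMr _ (hMn.conj_mem _ (M.inv_mem hx) (g : G ⧸ K)) x hx hgx hxp
    rw [conj_pow] at e
    have e' : (g : G ⧸ K) * x ^ p * (g : G ⧸ K)⁻¹ = (x ^ q)⁻¹ := by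
      rw [← e]; group
    refine ⟨g, fun z hz hzK => ?_⟩
    have hzM : (z : G ⧸ K) ∈ M := (memM z).2 hz
    obtain ⟨s, t, hs, hst⟩ : ∃ (s : ℕ) (t : ℤ), 0 < s ∧ (z : G ⧸ K) ^ s = x ^ t := by
      rcases r.pos_or (fun e => hzK ((QuotientGroup.eq_one_iff z).1 e)) with h1 | h1
      · obtain ⟨s, t, hs, -, e⟩ := hMr _ hzM x hx h1 hxp
        exact ⟨s, t, hs, by simpa using e⟩
      · obtain ⟨s, t, hs, -, e⟩ := hMr _ (M.inv_mem hzM) x hx h1 hxp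
        refine ⟨s, -t, hs, ?_⟩
        rw [zpow_neg, zpow_natCast, ← e, inv_pow, inv_inv]
    -- The relation `z ^ s = x ^ t` carries the reversal from `x` to `z`; the factor `2` makes both
    -- exponents at least `2`.
    refine ⟨2 * (s * p), 2 * (s * q), ?_, ?_, ?_⟩
    · have := Nat.mul_pos hs hp; omega
    · have := Nat.mul_pos hs hq; omega
    · rw [← QuotientGroup.eq_one_iff]
      have hz : ∀ n : ℕ, (z : G ⧸ K) ^ (2 * (s * n)) = (x ^ n) ^ (t * 2) := by
        intro n
        rw [show 2 * (s * n) = s * (n * 2) by ring, pow_mul, hst, ← zpow_natCast, ← zpow_natCast,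
          ← zpow_mul, ← zpow_mul]
        congr 1
        push_cast
        ring
      have e2 : (g : G ⧸ K) * (x ^ p) ^ (t * 2) * (g : G ⧸ K)⁻¹ = ((x ^ q)⁻¹) ^ (t * 2) := by
        rw [← e', conj_zpow]
      change (g : G ⧸ K) * (z : G ⧸ K) ^ (2 * (s * p)) * (g : G ⧸ K)⁻¹ *
        (z : G ⧸ K) ^ (2 * (s * q)) = 1
      rw [hz, hz, e2, inv_zpow, inv_mul_cancel]

/-! ### Finiteness of the set of orderings -/

/-- An ordering for which `N` is convex, where `N` has a rank one quotient, is determined by the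
restriction to `N` and the sign of one element outside of `N`. -/
theorem RankOneMod.eq_of_restrict_eq {N : Subgroup G} [N.Normal] (hr : RankOneMod N)
    {o₁ o₂ : LeftOrdering G} (h₁ : o₁.IsConvex (N : Set G)) (h₂ : o₂.IsConvex (N : Set G))
    (hN : o₁.restrict N = o₂.restrict N) {y : G} (hy : y ∉ N) (hpos : o₁.Pos y ↔ o₂.Pos y) :
    o₁ = o₂ := by
  obtain ⟨z, hzN, hz₁, hz₂⟩ : ∃ z, z ∉ N ∧ o₁.Pos z ∧ o₂.Pos z := by
    by_cases h : o₁.Pos y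
    · exact ⟨y, hy, h, hpos.1 h⟩
    · have hy1 : y ≠ 1 := fun e => hy (e ▸ N.one_mem)
      exact ⟨y⁻¹, fun h' => hy (N.inv_mem_iff.1 h'), o₁.pos_inv_of_not hy1 h,
        o₂.pos_inv_of_not hy1 fun h' => h (hpos.2 h')⟩
  refine (eq_of_pos_imp fun g hg => ?_).symm
  by_cases hgN : g ∈ N
  · have : (o₁.restrict N).Pos ⟨g, hgN⟩ := o₁.pos_restrict.2 hg
    rw [hN] at this
    exact o₂.pos_restrict.1 this
  -- A positive power of `g` lies in the coset of a positive power of `z`, and this coset is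
  -- positive for `o₂` as well.
  · obtain ⟨p, q, hp, hpq⟩ := hr g z hzN
    obtain ⟨s, hs, hmem⟩ := h₁.exists_pow_mul_mem hg hz₁ hgN hp hpq
    refine o₂.pos_of_pow (n := p) ?_
    have := h₂.pos_mul (fun h' => hzN (h₂.mem_of_pow_mem hs h')) hmem (hz₂.pow hs)
    simpa using this

/-- A group with an isolated Conradian ordering has finitely many orderings, all with the same
convex subgroups. -/
theorem IsolatedBy.finite_of_isConradian {G : Type*} [Group G] {o : LeftOrdering G} {F : Finset G}
    (h : o.IsolatedBy F) (hC : o.IsConradian) :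
    Finite (LeftOrdering G) ∧ ∀ (o' : LeftOrdering G) (H : Subgroup G),
      o'.IsConvex (H : Set G) ↔ o.IsConvex (H : Set G) := by
  classical
  induction hn : F.card using Nat.strong_induction_on generalizing G with
  | _ n ih =>
  rcases subsingleton_or_nontrivial G with hG | hG
  · have hp : ∀ (o : LeftOrdering G) g, ¬ o.Pos g := fun o g hg => hg.ne_one (Subsingleton.elim _ _)
    have : Subsingleton (LeftOrdering G) :=
      ⟨fun o₁ o₂ => (eq_of_pos_imp fun g hg => absurd hg (hp o₁ g)).symm⟩
    exact ⟨inferInstance, fun o' H => by rw [Subsingleton.elim o' o]⟩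
  obtain ⟨N, hN⟩ := h.exists_isMaxConvex
  have hNn := hN.normal hC
  obtain ⟨-, hr⟩ := h.rankOneMod hC hN
  have hres := h.restrict hN.convex
  have hcard : (F.subtype (· ∈ N)).card < n := by
    obtain ⟨f, hf, -, hfN⟩ := h.exists_mem_diff hN.convex o.isConvex_top (lt_top_iff_ne_top.2 hN.ne_top)
    rw [Finset.card_subtype, ← hn]
    exact Finset.card_lt_card (Finset.filter_ssubset.2 ⟨f, hf, hfN⟩)
  obtain ⟨hfin, hall⟩ := ih _ hcard hres (hC.restrict N) rfl
  have hconv : ∀ o' : LeftOrdering G, o'.IsConvex (N : Set G) := by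
    intro o'
    rcases subsingleton_or_nontrivial N with hsub | hnt
    · rw [N.eq_bot_of_subsingleton]
      exact o'.isConvex_bot
    · obtain ⟨N', hN'⟩ := hres.exists_isMaxConvex
      -- Conjugation by `g` is an automorphism of `N`, and automorphisms preserve `N'` since all
      -- orderings on `N` have the same convex subgroups.
      have hK : (N'.map N.subtype).Normal := by
        refine ⟨?_⟩
        rintro _ ⟨x, hx, rfl⟩ g
        refine ⟨MulAut.conjNormal g x, ?_, by simp⟩
        refine hN'.mem_of_mulEquiv (fun o' H => (hall o' H).1) (MulAut.conjNormal g).symm ?_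
        simpa using hx
      obtain ⟨g, hg⟩ := h.exists_isReversedBy hC hN hN'
      have hsub : (N'.map N.subtype).subgroupOf N = N' :=
        Subgroup.comap_map_eq_self_of_injective N.subtype_injective N'
      refine hg.isConvex (lt_of_le_of_ne (Subgroup.map_subtype_le N') fun e => hN'.ne_top ?_) hr o' ?_
      · rw [← hsub, e, Subgroup.subgroupOf_self]
      · rw [hsub]
        exact (hall _ _).2 hN'.convex
  have himp : ∀ (o₁ o₂ : LeftOrdering G) (H : Subgroup G), o₁.IsConvex (H : Set G) →
      o₂.IsConvex (H : Set G) := by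
    intro o₁ o₂ H hH
    rcases IsConvex.le_total hH (hconv o₁) with h' | h'
    · have h1 := (hall (o₂.restrict N) _).2 ((hall (o₁.restrict N) _).1 (hH.subgroupOf N))
      have h2 := (hconv o₂).map_subtype h1
      rwa [Subgroup.subgroupOf_map_subtype, inf_eq_left.2 h'] at h2
    · by_cases hHN : H ≤ N
      · rw [_root_.le_antisymm hHN h']
        exact hconv o₂
      · obtain ⟨z, hzH, hzN⟩ := SetLike.not_le_iff_exists.1 hHN
        rw [hr.eq_top hH h' hzN hzH]
        exact o₂.isConvex_top
  refine ⟨?_, fun o' H => ⟨himp o' o H, himp o o' H⟩⟩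
  obtain ⟨y, -, hy⟩ := SetLike.not_le_iff_exists.1 fun h' : ⊤ ≤ N => hN.ne_top (top_le_iff.1 h')
  refine Finite.of_injective (β := LeftOrdering N × Prop)
    (fun o' => (o'.restrict N, o'.Pos y)) fun o₁ o₂ e => ?_
  rw [Prod.mk.injEq] at e
  exact hr.eq_of_restrict_eq (hconv o₁) (hconv o₂) e.1 hy e.2.to_iff

end LeftOrdering

theorem proposition2p3 {Γ : Type*} [Group Γ] [Nontrivial Γ] (o : LeftOrdering Γ)
    (ho : IsOpen ({o} : Set (LeftOrdering Γ))) :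
    o.conradianSoul ≠ ⊥ ∧ Finite (LeftOrdering o.conradianSoul) := by
  classical
  obtain ⟨F, hF⟩ := LeftOrdering.exists_isolatedBy_of_isOpen ho
  obtain ⟨hconv, hC⟩ := o.isGreatest_conradianSoul.1
  exact ⟨hF.conradianSoul_ne_bot, ((hF.restrict hconv).finite_of_isConradian hC).1⟩
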